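/- Let $K$ be an algebraically closed field of characteristic $2$. For a homogeneous polynomial $B \in K[x_1,x_2,x_3]$ of degree $4$ let $$X_B := \{ (x_1:x_2:x_3:z) \in \mathbb{P}^3_K \mid z^4 + B(x_1,x_2,x_3) = 0 \}.$$ (1) If $X_B$ is normal, then $X_B$ has at most $7$ singular points. (2) For general $B$, that is, for all $B$ in some nonempty Zariski open subset of the $15$-dimensional vector space $K[x_1,x_2,x_3]_4$, the surface $X_B$ is normal and has exactly $7$ singular points, and each of them is an $A_3$-singularity, that is, there $X_B$ is formally equivalent to $xy = z^4$ at the origin. -/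

import Mathlib

open scoped LinearAlgebra.Projectivization

noncomputable section

namespace QuarticSurface

variable {K : Type*} [Field K]

/-- A commutative ring is normal if all its localizations at prime ideals are
integrally closed domains. -/
def IsNormalRing (R : Type*) [CommRing R] : Prop :=
  ∀ (p : Ideal R) [p.IsPrime],
    IsDomain (Localization.AtPrime p) ∧ IsIntegrallyClosed (Localization.AtPrime p)

/-- Dehomogenization in the `i`-th standard affine chart of `ℙ³`: the `i`-th homogeneous
coordinate is set equal to `1`, the other three (in their order) become the affine
coordinates. -/
def dehomogenize (i : Fin 4) (F : MvPolynomial (Fin 4) K) : MvPolynomial (Fin 3) K :=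
  MvPolynomial.aeval (i.insertNth (1 : MvPolynomial (Fin 3) K) MvPolynomial.X) F

/-- The coordinate ring of the part of the surface `F = 0` in the `i`-th standard
affine chart of `ℙ³`. -/
abbrev ChartRing (F : MvPolynomial (Fin 4) K) (i : Fin 4) : Type _ :=
  MvPolynomial (Fin 3) K ⧸ Ideal.span {dehomogenize i F}

/-- The projective surface (scheme) `F = 0` in `ℙ³` is normal: all its local rings are
integrally closed domains. This is read off on the four standard affine charts, which
cover it. -/
def IsNormalSurface (F : MvPolynomial (Fin 4) K) : Prop :=
  ∀ i : Fin 4, IsNormalRing (ChartRing F i)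

/-- The set of singular points of the surface `F = 0` in `ℙ³` (`F` homogeneous): the points
of the surface where all partial derivatives of `F` vanish. -/
def singularPoints (F : MvPolynomial (Fin 4) K) : Set (ℙ K (Fin 4 → K)) :=
  {P | MvPolynomial.eval P.rep F = 0 ∧
    ∀ i, MvPolynomial.eval P.rep (MvPolynomial.pderiv i F) = 0}

/-- The affine Taylor expansion of `F` at the point with homogeneous coordinates `v`,
in the `i`-th standard affine chart (meaningful when `v i ≠ 0`): the local equation of the
surface at that point, as a formal power series in three affine coordinates centred there. -/
def taylor (F : MvPolynomial (Fin 4) K) (v : Fin 4 → K) (i : Fin 4) :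
    MvPowerSeries (Fin 3) K :=
  ((MvPolynomial.aeval
    (fun j : Fin 3 => MvPolynomial.X j + MvPolynomial.C (v (i.succAbove j) / v i))
    (dehomogenize i F) : MvPolynomial (Fin 3) K) : MvPowerSeries (Fin 3) K)

/-- The surface `F = 0` has an `Aₙ`-singularity at `P`: at `P` it is formally equivalent to
`xy = zⁿ⁺¹` at the origin, that is, some automorphism of `K⟦x, y, z⟧` carries the ideal of
its local equation at `P`, in an affine chart containing `P`, to the ideal `(xy - zⁿ⁺¹)`. -/
def HasTypeA (n : ℕ) (F : MvPolynomial (Fin 4) K) (P : ℙ K (Fin 4 → K)) : Prop :=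
  ∃ i : Fin 4, P.rep i ≠ 0 ∧
    ∃ φ : MvPowerSeries (Fin 3) K ≃ₐ[K] MvPowerSeries (Fin 3) K,
      Ideal.map φ (Ideal.span {taylor F P.rep i}) =
        Ideal.span {MvPowerSeries.X 0 * MvPowerSeries.X 1 - MvPowerSeries.X 2 ^ (n + 1)}

/-- A property holds for the general ternary form of degree `d`: it holds on a nonempty
principal Zariski open subset of the affine space of all such forms, whose coordinates are
the coefficients. (Over an infinite field `G ≠ 0` says exactly that `G` does not vanish
identically on that space.) -/
def ForGeneralForm (d : ℕ) (p : MvPolynomial (Fin 3) K → Prop) : Prop :=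
  ∃ G : MvPolynomial {m : Fin 3 →₀ ℕ // m.degree = d} K, G ≠ 0 ∧
    ∀ B : MvPolynomial (Fin 3) K, B.IsHomogeneous d →
      MvPolynomial.eval (fun m => MvPolynomial.coeff m.1 B) G ≠ 0 → p B

/-- The quartic form `z⁴ + B(x₁, x₂, x₃)`; the coordinates `x₁, x₂, x₃, z` have the
indices `0, 1, 2, 3`. -/
def quartic (B : MvPolynomial (Fin 3) K) : MvPolynomial (Fin 4) K :=
  MvPolynomial.X 3 ^ 4 + MvPolynomial.rename Fin.castSucc B

end QuarticSurface

end

/-!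
Over an algebraically closed field `K` of characteristic two, every quartic form can be written
`B = q² + ∑ᵢ x_{i+1} x_{i+2} lᵢ²` (indices modulo 3) with linear forms `lᵢ`, because a quartic
monomial is either a square or has exactly two odd exponents. The squares have derivative zero, so
the partial derivatives of `B` are the entries of the cross product of `x` with
`φ(x) = (l₀(x)², l₁(x)², l₂(x)²)`. As fourth roots in `K` exist and are unique, the singular points
of `z⁴ + B = 0` correspond to the lines `K x` with `φ(x) ∈ K x`. The map `φ` is
Frobenius-semilinear, and everything is governed by the rank of the matrix `L` of the `lᵢ`.

* A line with `φ(x) = c x`, `c ≠ 0`, contains exactly one nonzero fixed vector of `φ`. The fixed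
  vectors form an `𝔽₂`-space with a `K`-linearly independent basis, and their `K`-span meets the
  kernel only in zero (`FrobeniusSemilinear.encard_fixed`). If `φ` is injective, they span
  `K³` (`FrobeniusSemilinear.span_fixed_eq_top`), which gives `2³ - 1 = 7` singular points. If the
  kernel is a line, there are at most `(2² - 1) + 1 = 4`.
* If the kernel has dimension at least two, the `lᵢ` are multiples of one form `l`, the equation is
  `(z² + q)² = l² m`, and `(z² + q) / l` is integral over, but not contained in, a local ring of the
  surface (`QuarticSurface.not_isNormalSurface`).
* If `φ` is injective, the partial derivatives of `B` have no common factor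
  (`QuarticSurface.isUnit_of_dvd_pderiv`). This makes `K[x₁, x₂, x₃][z] / (z⁴ - B)` normal: the
  fourth power of an integral element `∑ pᵢ zⁱ / s` is a polynomial, and differentiating this fact
  twice shows that `s` divides every `pᵢ` (`QuarticExtension.dvd_of_pow_four_dvd`). The affine
  charts are retracts of localizations of this ring, and a retract of a normal domain is normal.
* At a singular point `x` with `xᵢ = 1` and `φ(x) = c x`, `c ≠ 0`, the quartic is
  `z⁴ + a u² + c u v + b v²` in affine coordinates `u, v, z`. A quadratic equation with unit middle
  coefficient is solvable in power series, so the last three terms factor into two series with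
  independent linear parts, and the formal inverse function theorem
  (`MvPowerSeries.bijective_subst`) gives the type `A₃`.

The injectivity of `φ` is the nonvanishing of `det L`, and `(det L)²` is a polynomial in the
coefficients of `B` (`QuarticSurface.oddDet`).
-/

/-! ### Fixed vectors of Frobenius-semilinear maps -/

namespace FrobeniusSemilinear

open Polynomial Module

variable {K V : Type*} [Field K]

/-- The coefficients of a `φ`-fixed vector `∑ cᵢ φⁱ v`, as polynomials in its last coefficient,
when `φⁿ v = ∑ aᵢ φⁱ v`. -/
noncomputable def fixedCoeff (a : ℕ → K) : ℕ → K[X]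
  | 0 => C (a 0) * X ^ 2
  | i + 1 => fixedCoeff a i ^ 2 + C (a (i + 1)) * X ^ 2

lemma X_sq_dvd_fixedCoeff (a : ℕ → K) (i : ℕ) : X ^ 2 ∣ fixedCoeff a i := by
  induction i with
  | zero => exact Dvd.intro_left _ rfl
  | succ i ih => exact dvd_add (dvd_pow ih two_ne_zero) (Dvd.intro_left _ rfl)

lemma two_le_natDegree_fixedCoeff (a : ℕ → K) (i : ℕ) :
    (∃ j ≤ i, a j ≠ 0) → 2 ≤ (fixedCoeff a i).natDegree := by
  induction i with
  | zero =>
    rintro ⟨j, hj, h⟩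
    obtain rfl : j = 0 := by omega
    simp [fixedCoeff, natDegree_C_mul_X_pow _ _ h]
  | succ i ih =>
    rintro ⟨j, hj, h⟩
    by_cases h' : ∃ j ≤ i, a j ≠ 0
    · have := ih h'
      have h2 : (C (a (i + 1)) * X ^ 2).natDegree ≤ 2 := natDegree_C_mul_X_pow_le _ _
      have h3 : (fixedCoeff a i ^ 2).natDegree = 2 * (fixedCoeff a i).natDegree := natDegree_pow _ _
      rw [fixedCoeff, natDegree_add_eq_left_of_natDegree_lt] <;> omega
    · push Not at h'
      have h0 : ∀ k ≤ i, fixedCoeff a k = 0 := by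
        intro k
        induction k with
        | zero => intro hk; simp [fixedCoeff, h' 0 hk]
        | succ k ihk => intro hk; simp [fixedCoeff, h' _ hk, ihk (by omega)]
      obtain rfl : j = i + 1 := by
        by_contra hne
        exact h (h' j (by omega))
      simp [fixedCoeff, h0 i le_rfl, natDegree_C_mul_X_pow _ _ h]

/-- The equation `fixedCoeff a n = X` is additive; divided by `X` it is nonconstant with nonzero
constant term. -/
lemma exists_fixedCoeff_root [IsAlgClosed K] (a : ℕ → K) (n : ℕ) (h : ∃ j ≤ n, a j ≠ 0) :
    ∃ t : K, t ≠ 0 ∧ (fixedCoeff a n).eval t = t := by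
  obtain ⟨D, hD⟩ := X_sq_dvd_fixedCoeff a n
  have hne : D ≠ 0 := by
    rintro rfl
    have := two_le_natDegree_fixedCoeff a n h
    simp [hD] at this
  have hdeg : (X * D - 1).natDegree = D.natDegree + 1 := by
    rw [← C_1, natDegree_sub_C, natDegree_X_mul hne]
  obtain ⟨t, ht⟩ := IsAlgClosed.exists_root (X * D - 1)
    (fun h0 => by have := natDegree_eq_zero_iff_degree_le_zero.mpr h0.le; omega)
  have ht' : t * D.eval t = 1 := by simpa [IsRoot, sub_eq_zero] using ht
  refine ⟨t, fun h0 => by simp [h0] at ht', ?_⟩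
  rw [hD, eval_mul, eval_pow, eval_X, pow_two, mul_assoc, ht', mul_one]

variable [CharP K 2] [AddCommGroup V] [Module K V]

/-- A Frobenius-semilinear injection of a nonzero finite-dimensional space has a nonzero fixed
vector. -/
theorem exists_fixed [IsAlgClosed K] [FiniteDimensional K V] [Nontrivial V]
    (f : V →ₛₗ[frobenius K 2] V) (hf : Function.Injective f) : ∃ w ≠ 0, f w = w := by
  classical
  obtain ⟨v, hv⟩ := exists_ne (0 : V)
  set u : ℕ → V := fun i => f^[i] v with hu
  have hus : ∀ i, f (u i) = u (i + 1) := fun i => (Function.iterate_succ_apply' f i v).symm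
  have hu0 : ∀ i, u i ≠ 0 := by
    intro i
    induction i with
    | zero => exact hv
    | succ i ih => rw [← hus]; exact fun h => ih (hf (by rw [h, map_zero]))
  have hex : ∃ n, ¬ LinearIndependent K (fun i : Fin n => u i) := by
    refine ⟨finrank K V + 1, fun h => ?_⟩
    have := h.fintype_card_le_finrank
    simp at this
  -- `n` is the length of the first dependent initial segment of the orbit
  obtain ⟨n, hn, hmin⟩ : ∃ n, ¬ LinearIndependent K (fun i : Fin n => u i) ∧
      ∀ m < n, LinearIndependent K (fun i : Fin m => u i) :=
    ⟨Nat.find hex, Nat.find_spec hex, fun m hm => not_not.mp (Nat.find_min hex hm)⟩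
  obtain _ | _ | M := n
  · exact absurd linearIndependent_empty_type hn
  · exact absurd ((linearIndependent_unique_iff (v := fun i : Fin 1 => u i)).mpr (hu0 _)) hn
  have hLI := hmin (M + 1) (by omega)
  have hmem : u (M + 1) ∈ Submodule.span K (Set.range fun i : Fin (M + 1) => u i) := by
    by_contra hnot
    apply hn
    convert linearIndependent_finSnoc.mpr ⟨hLI, hnot⟩ using 1
    ext i
    refine Fin.lastCases ?_ (fun j => ?_) i <;> simp
  obtain ⟨a', ha'⟩ := (Submodule.mem_span_range_iff_exists_fun K).mp hmem
  set a : ℕ → K := fun i => if h : i < M + 1 then a' ⟨i, h⟩ else 0 with ha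
  have hrel : u (M + 1) = ∑ i ∈ Finset.range (M + 1), a i • u i := by
    rw [← ha', Finset.sum_range]
    exact Finset.sum_congr rfl fun i _ => by rw [ha]; simp only [i.isLt, dif_pos]
  have hane : ∃ j ≤ M, a j ≠ 0 := by
    by_contra! h
    refine hu0 (M + 1) ?_
    rw [hrel]
    exact Finset.sum_eq_zero fun i hi => by
      rw [h i (by simpa [Nat.lt_succ_iff] using hi), zero_smul]
  obtain ⟨t, ht0, ht⟩ := exists_fixedCoeff_root a M hane
  set c : ℕ → K := fun i => (fixedCoeff a i).eval t with hc
  refine ⟨∑ i ∈ Finset.range (M + 1), c i • u i, fun h0 => ?_, ?_⟩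
  · rw [Finset.sum_range] at h0
    have := Fintype.linearIndependent_iff.mp hLI _ h0 (Fin.last M)
    exact ht0 (by simpa [hc, ht] using this)
  · have h1 : f (∑ i ∈ Finset.range (M + 1), c i • u i) =
        ∑ i ∈ Finset.range (M + 1), (c i ^ 2) • u (i + 1) := by
      rw [map_sum]
      exact Finset.sum_congr rfl fun i _ => by rw [map_smulₛₗ, hus, frobenius_def]
    have h2 : c M = t := ht
    rw [h1, Finset.sum_range_succ, h2, hrel, Finset.sum_range_succ' (fun i => a i • u i),
      Finset.sum_range_succ' (fun i => c i • u i), smul_add, Finset.smul_sum, ← add_assoc,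
      ← Finset.sum_add_distrib]
    congr 1
    · refine Finset.sum_congr rfl fun i _ => ?_
      rw [smul_smul, ← add_smul]
      congr 1
      simp [hc, fixedCoeff]
      ring
    · rw [smul_smul]
      congr 1
      simp [hc, fixedCoeff]
      ring

/-- The vectors fixed by a Frobenius-semilinear injection span (a form of Lang's theorem for the
general linear group). -/
theorem span_fixed_eq_top [IsAlgClosed K] [FiniteDimensional K V]
    (f : V →ₛₗ[frobenius K 2] V) (hf : Function.Injective f) :
    Submodule.span K {w | f w = w} = ⊤ := by
  set W := Submodule.span K {w | f w = w} with hW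
  by_contra hne
  have hmap : W ≤ W.comap f := Submodule.span_le.mpr fun w hw => by
    change f w ∈ W
    rw [show f w = w from hw]
    exact Submodule.subset_span hw
  -- `f` and `f - 1` are surjective on `W`, because squaring and `t ↦ t² - t` are so on `K`
  have hsurj : ∀ x ∈ W, ∀ c : K, ∃ y ∈ W, f y = c • x := by
    intro x hx
    induction hx using Submodule.span_induction with
    | mem w hw =>
      intro c
      obtain ⟨d, hd⟩ := IsAlgClosed.exists_pow_nat_eq c (n := 2) two_pos
      refine ⟨d • w, W.smul_mem _ (Submodule.subset_span hw), ?_⟩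
      rw [map_smulₛₗ, frobenius_def, hd, show f w = w from hw]
    | zero => exact fun c => ⟨0, W.zero_mem, by simp⟩
    | add x y _ _ hx hy =>
      intro c
      obtain ⟨x', hx', hx⟩ := hx c
      obtain ⟨y', hy', hy⟩ := hy c
      exact ⟨x' + y', W.add_mem hx' hy', by rw [map_add, hx, hy, smul_add]⟩
    | smul a x _ hx => exact fun c => by rw [smul_smul]; exact hx _
  have hsurj' : ∀ x ∈ W, ∀ c : K, ∃ y ∈ W, f y - y = c • x := by
    intro x hx
    induction hx using Submodule.span_induction with
    | mem w hw =>
      intro c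
      obtain ⟨d, hd⟩ := IsAlgClosed.exists_root (X ^ 2 - X - C c : K[X]) (by
        rw [show (X ^ 2 - X - C c : K[X]) = C 1 * X ^ 2 + C (-1) * X + C (-c) by simp; ring,
          degree_quadratic one_ne_zero]
        decide)
      have hd' : d ^ 2 - d = c := by simpa [IsRoot, sub_eq_zero] using hd
      refine ⟨d • w, W.smul_mem _ (Submodule.subset_span hw), ?_⟩
      rw [map_smulₛₗ, frobenius_def, show f w = w from hw, ← sub_smul, hd']
    | zero => exact fun c => ⟨0, W.zero_mem, by simp⟩
    | add x y _ _ hx hy =>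
      intro c
      obtain ⟨x', hx', hx⟩ := hx c
      obtain ⟨y', hy', hy⟩ := hy c
      exact ⟨x' + y', W.add_mem hx' hy', by rw [map_add, smul_add, ← hx, ← hy]; abel⟩
    | smul a x _ hx => exact fun c => by rw [smul_smul]; exact hx _
  have : Nontrivial (V ⧸ W) := Submodule.Quotient.nontrivial_iff.mpr hne
  have hinj : Function.Injective (W.mapQ W f hmap) := by
    rw [injective_iff_map_eq_zero]
    intro x
    induction x using Submodule.Quotient.induction_on with
    | H x =>
      rw [Submodule.mapQ_apply, Submodule.Quotient.mk_eq_zero, Submodule.Quotient.mk_eq_zero]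
      intro hx
      obtain ⟨y, hy, hyx⟩ := hsurj _ hx 1
      rw [one_smul] at hyx
      rwa [← hf hyx]
  obtain ⟨w, hw0, hw⟩ := exists_fixed _ hinj
  induction w using Submodule.Quotient.induction_on with
  | H v =>
    rw [Submodule.mapQ_apply, Submodule.Quotient.eq] at hw
    obtain ⟨y, hy, hyv⟩ := hsurj' _ hw 1
    refine hw0 ((Submodule.Quotient.mk_eq_zero W).mpr ?_)
    have hfix : v - y ∈ W := Submodule.subset_span (by
      change f (v - y) = v - y
      rw [one_smul, sub_eq_sub_iff_add_eq_add] at hyv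
      rw [map_sub, sub_eq_sub_iff_add_eq_add, add_comm v, hyv])
    simpa using W.add_mem hfix hy

/-- The number of fixed vectors is `2 ^ d`, where `d` is the dimension of their span: they are the
`𝔽₂`-combinations of a basis of this span consisting of fixed vectors. -/
theorem encard_fixed [FiniteDimensional K V] (f : V →ₛₗ[frobenius K 2] V) :
    {w | f w = w}.encard = 2 ^ finrank K (Submodule.span K {w | f w = w}) ∧
      finrank K (Submodule.span K {w | f w = w}) + finrank K (LinearMap.ker f) ≤ finrank K V := by
  classical
  obtain ⟨b, hb, hspan, hLI⟩ := exists_linearIndependent K {w | f w = w}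
  lift b to Finset V using LinearIndependent.set_finite_of_isNoetherian hLI
  have hcard : finrank K (Submodule.span K {w | f w = w}) = b.card := by
    rw [← hspan]
    exact finrank_span_finset_eq_card hLI
  have hcoord : ∀ x ∈ Submodule.span K {w | f w = w}, ∃ c : V → K, ∑ y ∈ b, c y • y = x := by
    intro x hx
    rw [← hspan] at hx
    obtain ⟨c, -, hc⟩ := Submodule.mem_span_finset.mp hx
    exact ⟨c, hc⟩
  have huniq : ∀ c c' : V → K, ∑ y ∈ b, c y • y = ∑ y ∈ b, c' y • y → ∀ y ∈ b, c y = c' y := by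
    intro c c' h y hy
    have := linearIndependent_iff'.mp hLI b.attach (fun y => c y - c' y) (by
      refine (Finset.sum_attach b (fun y => (c y - c' y) • y)).trans ?_
      simp [sub_smul, h]) ⟨y, hy⟩ (by simp)
    exact sub_eq_zero.mp this
  have hfc : ∀ c : V → K, f (∑ y ∈ b, c y • y) = ∑ y ∈ b, (c y ^ 2) • y := by
    intro c
    rw [map_sum]
    exact Finset.sum_congr rfl fun y hy => by
      rw [map_smulₛₗ, frobenius_def, show f y = y from hb hy]
  constructor
  · have himage : {w | f w = w} = ((b.powerset.image fun s => ∑ y ∈ s, y : Finset V) : Set V) := by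
      ext w
      simp only [Set.mem_ofPred_eq, Finset.coe_image, Set.mem_image, Finset.mem_coe,
        Finset.mem_powerset]
      constructor
      · intro hw
        obtain ⟨c, rfl⟩ := hcoord w (Submodule.subset_span hw)
        rw [hfc] at hw
        have h01 := huniq _ _ hw
        refine ⟨b.filter fun y => c y = 1, Finset.filter_subset _ _, ?_⟩
        rw [Finset.sum_filter]
        refine Finset.sum_congr rfl fun y hy => ?_
        have h : c y * (c y - 1) = 0 := by linear_combination h01 y hy
        rcases mul_eq_zero.mp h with h | h
        · simp [h]
        · simp [sub_eq_zero.mp h]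
      · rintro ⟨s, hs, rfl⟩
        rw [map_sum]
        exact Finset.sum_congr rfl fun y hy => hb (hs hy)
    rw [hcard, himage, Set.encard_coe_eq_coe_finsetCard, Finset.card_image_of_injOn,
      Finset.card_powerset]
    · norm_cast
    · intro s hs t ht hst
      have hs' : s ⊆ b := by simpa using hs
      have ht' : t ⊆ b := by simpa using ht
      have key : ∀ r ⊆ b, ∑ y ∈ r, y = ∑ y ∈ b, (if y ∈ r then (1 : K) else 0) • y := by
        intro r hr
        simp only [ite_smul, one_smul, zero_smul]
        rw [← Finset.sum_filter, Finset.filter_mem_eq_inter, Finset.inter_eq_right.mpr hr]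
      have h := huniq (fun y => if y ∈ s then 1 else 0) (fun y => if y ∈ t then 1 else 0)
        (by rw [← key s hs', ← key t ht']; exact hst)
      ext y
      by_cases hy : y ∈ b
      · have := h y hy
        clear * - this
        by_cases h1 : y ∈ s <;> by_cases h2 : y ∈ t <;> simp [h1, h2] at this ⊢
      · exact ⟨fun h => absurd (hs' h) hy, fun h => absurd (ht' h) hy⟩
  · refine Submodule.finrank_add_finrank_le_of_disjoint ?_
    rw [Submodule.disjoint_def]
    intro x hx hker
    obtain ⟨c, rfl⟩ := hcoord x hx
    have hzero : ∑ y ∈ b, (c y ^ 2) • y = ∑ y ∈ b, (0 : K) • y := by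
      rw [← hfc, LinearMap.mem_ker.mp hker]
      simp
    refine Finset.sum_eq_zero fun y hy => ?_
    have := huniq (fun y => c y ^ 2) (fun _ => 0) hzero y hy
    rw [pow_eq_zero_iff two_ne_zero |>.mp this, zero_smul]

end FrobeniusSemilinear

/-! ### Normality of purely inseparable quartic extensions -/

namespace QuarticExtension

open Polynomial

variable {A : Type*} [CommRing A] [CharP A 2] [IsDomain A]

/-- The divisibility that makes `A[z]/(z⁴ - f)` normal: differentiating a congruence modulo
`q⁴` kills the even-indexed terms, and the elements `D j f` have no common factor. -/
theorem dvd_of_pow_four_dvd [UniqueFactorizationMonoid A] [IsIntegrallyClosed A] {ι : Type*}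
    (D : ι → Derivation ℤ A A) (f : A) (hf : ∀ d, (∀ j, d ∣ D j f) → IsUnit d)
    {q p₀ p₁ p₂ p₃ : A} (h : q ^ 4 ∣ p₀ ^ 4 + p₁ ^ 4 * f + p₂ ^ 4 * f ^ 2 + p₃ ^ 4 * f ^ 3) :
    q ∣ p₀ ∧ q ∣ p₁ ∧ q ∣ p₂ ∧ q ∣ p₃ := by
  -- an element dividing all `h * D j f` divides `h`
  have hcop : ∀ a b : A, (∀ j, a ∣ b * D j f) → a ∣ b := by
    intro a b h
    rcases eq_or_ne a 0 with rfl | ha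
    · by_contra hb
      refine not_isUnit_zero (hf 0 fun j => ?_)
      rw [(mul_eq_zero.mp (zero_dvd_iff.mp (h j))).resolve_left fun h0 => hb (by rw [h0])]
    · obtain ⟨a', b', c, hrel, rfl, rfl⟩ :=
        UniqueFactorizationMonoid.exists_reduced_factors a ha b
      have hc : c ≠ 0 := left_ne_zero_of_mul ha
      have hu : IsUnit a' := hf a' fun j => hrel.dvd_of_dvd_mul_left
        ((mul_dvd_mul_iff_left hc).mp (by simpa only [mul_assoc] using h j))
      exact mul_dvd_mul_left c hu.dvd
  have hsq : ∀ (j) (a : A), D j (a ^ 2) = 0 := by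
    intro j a
    rw [Derivation.leibniz_pow]
    simp [CharTwo.two_eq_zero]
  -- `q² ∣ a² + b² f` implies `q ∣ a` and `q ∣ b`
  have hstep : ∀ a b : A, q ^ 2 ∣ a ^ 2 + b ^ 2 * f → q ∣ a ∧ q ∣ b := by
    rintro a b ⟨c, hc⟩
    have hb : q ∣ b := by
      rw [← IsIntegrallyClosed.pow_dvd_pow_iff two_ne_zero]
      refine hcop _ _ fun j => ⟨D j c, ?_⟩
      have := congrArg (D j) hc
      simpa [hsq, Derivation.leibniz] using this
    refine ⟨?_, hb⟩
    rw [← IsIntegrallyClosed.pow_dvd_pow_iff two_ne_zero]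
    exact (dvd_add_left (dvd_mul_of_dvd_left (pow_dvd_pow_of_dvd hb 2) f)).mp ⟨c, hc⟩
  have h13 : q ^ 2 ∣ p₁ ^ 2 + p₃ ^ 2 * f := by
    rw [← IsIntegrallyClosed.pow_dvd_pow_iff two_ne_zero]
    obtain ⟨c, hc⟩ := h
    refine hcop _ _ fun j => ⟨D j c, ?_⟩
    have := congrArg (D j) (show (p₀ ^ 2 + p₂ ^ 2 * f) ^ 2 + ((p₁ ^ 2 + p₃ ^ 2 * f) ^ 2) * f =
      (q ^ 2) ^ 2 * c by rw [CharTwo.add_sq, CharTwo.add_sq]; linear_combination hc)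
    simpa [hsq, Derivation.leibniz] using this
  obtain ⟨h1, h3⟩ := hstep _ _ h13
  have h02 : q ^ 2 ∣ p₀ ^ 2 + p₂ ^ 2 * f := by
    rw [← IsIntegrallyClosed.pow_dvd_pow_iff two_ne_zero]
    have : (q ^ 2) ^ 2 ∣ (p₁ ^ 2 + p₃ ^ 2 * f) ^ 2 * f :=
      dvd_mul_of_dvd_left (pow_dvd_pow_of_dvd h13 2) f
    refine (dvd_add_left this).mp ?_
    convert h using 1
    · ring
    · rw [CharTwo.add_sq, CharTwo.add_sq]; ring
  obtain ⟨h0, h2⟩ := hstep _ _ h02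
  exact ⟨h0, h1, h2, h3⟩

omit [CharP A 2] [IsDomain A] in
lemma natDegree_X_pow_four_sub_C [Nontrivial A] (f : A) : (X ^ 4 - C f).natDegree = 4 :=
  natDegree_X_pow_sub_C

omit [CharP A 2] [IsDomain A] in
lemma root_pow_four (f : A) : AdjoinRoot.root (X ^ 4 - C f) ^ 4 = AdjoinRoot.of _ f := by
  have := AdjoinRoot.eval₂_root (X ^ 4 - C f)
  simpa [sub_eq_zero] using this

omit [CharP A 2] in
lemma of_injective (f : A) : Function.Injective (AdjoinRoot.of (X ^ 4 - C f)) :=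
  AdjoinRoot.of.injective_of_degree_ne_zero (by
    rw [degree_X_pow_sub_C (by norm_num)]
    decide)

omit [CharP A 2] in
lemma exists_eq_sum (f : A) (x : AdjoinRoot (X ^ 4 - C f)) : ∃ p₀ p₁ p₂ p₃ : A,
    x = AdjoinRoot.of _ p₀ + AdjoinRoot.of _ p₁ * AdjoinRoot.root _ +
      AdjoinRoot.of _ p₂ * AdjoinRoot.root _ ^ 2 + AdjoinRoot.of _ p₃ * AdjoinRoot.root _ ^ 3 := by
  obtain ⟨P, rfl⟩ := AdjoinRoot.mk_surjective x
  have hm : (X ^ 4 - C f).Monic := monic_X_pow_sub_C f (by norm_num)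
  have hmk : AdjoinRoot.mk (X ^ 4 - C f) P = AdjoinRoot.mk (X ^ 4 - C f) (P %ₘ (X ^ 4 - C f)) := by
    rw [AdjoinRoot.mk_eq_mk]
    exact ⟨P /ₘ (X ^ 4 - C f), by linear_combination -(modByMonic_add_div P (X ^ 4 - C f))⟩
  have hdeg : (P %ₘ (X ^ 4 - C f)).natDegree < 4 := by
    have := natDegree_modByMonic_lt P hm (fun h => by
      have := natDegree_X_pow_four_sub_C f
      simp [h] at this)
    rwa [natDegree_X_pow_four_sub_C] at this
  refine ⟨(P %ₘ (X ^ 4 - C f)).coeff 0, (P %ₘ (X ^ 4 - C f)).coeff 1,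
    (P %ₘ (X ^ 4 - C f)).coeff 2, (P %ₘ (X ^ 4 - C f)).coeff 3, ?_⟩
  rw [hmk]
  conv_lhs => rw [as_sum_range_C_mul_X_pow' (P %ₘ (X ^ 4 - C f)) hdeg]
  simp [Finset.sum_range_succ]

omit [IsDomain A] in
lemma add_pow_four (a b c d : A) : (a + b + c + d) ^ 4 = a ^ 4 + b ^ 4 + c ^ 4 + d ^ 4 := by
  rw [show (a + b + c + d) ^ 4 = ((a + b + c + d) ^ 2) ^ 2 by ring]
  simp only [CharTwo.add_sq]
  ring

lemma sum_pow_four (f p₀ p₁ p₂ p₃ : A) : (AdjoinRoot.of (X ^ 4 - C f) p₀ +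
    AdjoinRoot.of _ p₁ * AdjoinRoot.root _ + AdjoinRoot.of _ p₂ * AdjoinRoot.root _ ^ 2 +
      AdjoinRoot.of _ p₃ * AdjoinRoot.root _ ^ 3) ^ 4 =
    AdjoinRoot.of _ (p₀ ^ 4 + p₁ ^ 4 * f + p₂ ^ 4 * f ^ 2 + p₃ ^ 4 * f ^ 3) := by
  have := charP_of_injective_ringHom (of_injective f) 2
  rw [add_pow_four]
  simp only [map_add, map_mul, map_pow, ← root_pow_four]
  ring

section Normal

variable [UniqueFactorizationMonoid A] [IsIntegrallyClosed A] {ι : Type*}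
    (D : ι → Derivation ℤ A A) (f : A) (hf : ∀ d, (∀ j, d ∣ D j f) → IsUnit d)

include hf

/-- `A[z]/(z⁴ - f)` is a domain: a fourth power of an element lies in `A`, and it vanishes only for
the zero element, which is the case `q = 0` of `dvd_of_pow_four_dvd`. -/
theorem isDomain : IsDomain (AdjoinRoot (X ^ 4 - C f)) := by
  have hz : ∀ x : AdjoinRoot (X ^ 4 - C f), x ^ 4 = 0 → x = 0 := by
    intro x hx
    obtain ⟨p₀, p₁, p₂, p₃, rfl⟩ := exists_eq_sum f x
    rw [sum_pow_four, map_eq_zero_iff _ (of_injective f)] at hx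
    have := dvd_of_pow_four_dvd D f hf (q := 0) (by rw [hx]; exact dvd_zero _)
    simp only [zero_dvd_iff] at this
    obtain ⟨rfl, rfl, rfl, rfl⟩ := this
    simp
  have : Nontrivial (AdjoinRoot (X ^ 4 - C f)) := (of_injective f).nontrivial
  have : NoZeroDivisors (AdjoinRoot (X ^ 4 - C f)) := by
    refine ⟨fun {x y} hxy => ?_⟩
    have h4 : x ^ 4 * y ^ 4 = 0 := by rw [← mul_pow, hxy]; simp
    have hA : ∀ x : AdjoinRoot (X ^ 4 - C f), ∃ a, x ^ 4 = AdjoinRoot.of _ a := by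
      intro x
      obtain ⟨p₀, p₁, p₂, p₃, rfl⟩ := exists_eq_sum f x
      exact ⟨_, sum_pow_four f p₀ p₁ p₂ p₃⟩
    obtain ⟨a, ha⟩ := hA x
    obtain ⟨b, hb⟩ := hA y
    rw [ha, hb, ← map_mul, map_eq_zero_iff _ (of_injective f), mul_eq_zero] at h4
    rcases h4 with rfl | rfl
    · exact Or.inl (hz x (by rw [ha, map_zero]))
    · exact Or.inr (hz y (by rw [hb, map_zero]))
  exact NoZeroDivisors.to_isDomain _

theorem isIntegrallyClosed : IsIntegrallyClosed (AdjoinRoot (X ^ 4 - C f)) := by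
  have := isDomain D f hf
  set R := AdjoinRoot (X ^ 4 - C f) with hR
  have hinj : Function.Injective (algebraMap A R) := of_injective f
  have : FaithfulSMul A R := (faithfulSMul_iff_algebraMap_injective A R).mpr hinj
  have : Module.Finite A R := (monic_X_pow_sub_C f (by norm_num)).finite_adjoinRoot
  rw [isIntegrallyClosed_iff (FractionRing R)]
  intro x hx
  have hxA : IsIntegral A x := isIntegral_trans (R := A) x hx
  obtain ⟨a, b, hb, rfl⟩ := IsFractionRing.div_surjective (A := R) x
  have hb0 : b ≠ 0 := nonZeroDivisors.ne_zero hb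
  obtain ⟨β, hβ⟩ : ∃ β, b ^ 4 = algebraMap A R β := by
    obtain ⟨p₀, p₁, p₂, p₃, rfl⟩ := exists_eq_sum f b
    exact ⟨_, sum_pow_four f p₀ p₁ p₂ p₃⟩
  obtain ⟨p₀, p₁, p₂, p₃, hp⟩ := exists_eq_sum f (a * b ^ 3)
  have hp4 := sum_pow_four f p₀ p₁ p₂ p₃
  rw [← hp] at hp4
  set σ := p₀ ^ 4 + p₁ ^ 4 * f + p₂ ^ 4 * f ^ 2 + p₃ ^ 4 * f ^ 3 with hσ
  have hβ0 : β ≠ 0 := by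
    rintro rfl
    rw [map_zero] at hβ
    exact hb0 (pow_eq_zero_iff four_ne_zero |>.mp hβ)
  have hL : Function.Injective (algebraMap R (FractionRing R)) := IsFractionRing.injective _ _
  have hbL : algebraMap R (FractionRing R) b ≠ 0 := by
    rwa [Ne, map_eq_zero_iff _ hL]
  -- `x = a b³ / b⁴`, where `b⁴` lies in `A`
  have hx4 : (algebraMap R (FractionRing R) a / algebraMap R (FractionRing R) b) ^ 4 *
      algebraMap R (FractionRing R) (algebraMap A R (β ^ 4)) =
        algebraMap R (FractionRing R) (algebraMap A R σ) := by
    rw [map_pow (algebraMap A R), ← hβ, show algebraMap A R σ = (a * b ^ 3) ^ 4 from hp4.symm]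
    simp only [map_mul, map_pow]
    rw [div_pow, div_mul_eq_mul_div, div_eq_iff (pow_ne_zero 4 hbL)]
    ring
  let _ := FractionRing.liftAlgebra A (FractionRing R)
  have hdvd : β ^ 4 ∣ σ := by
    have hβA : algebraMap A (FractionRing A) (β ^ 4) ≠ 0 := by
      rw [Ne, map_eq_zero_iff _ (IsFractionRing.injective A (FractionRing A))]
      exact pow_ne_zero 4 hβ0
    have hint : IsIntegral A (algebraMap A (FractionRing A) σ /
        algebraMap A (FractionRing A) (β ^ 4)) := by
      rw [← isIntegral_algebraMap_iff (B := FractionRing R)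
        (algebraMap (FractionRing A) (FractionRing R)).injective]
      convert hxA.pow 4 using 1
      rw [map_div₀, ← IsScalarTower.algebraMap_apply, ← IsScalarTower.algebraMap_apply,
        IsScalarTower.algebraMap_apply A R (FractionRing R) σ, ← hx4,
        ← IsScalarTower.algebraMap_apply, mul_div_cancel_right₀]
      rw [IsScalarTower.algebraMap_apply A (FractionRing A) (FractionRing R)]
      exact (map_ne_zero_iff _ (algebraMap (FractionRing A) (FractionRing R)).injective).mpr hβA
    obtain ⟨c, hc⟩ := IsIntegrallyClosed.isIntegral_iff.mp hint
    refine ⟨c, IsFractionRing.injective A (FractionRing A) ?_⟩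
    rw [map_mul, hc, mul_div_cancel₀ _ hβA]
  obtain ⟨⟨c₀, rfl⟩, ⟨c₁, rfl⟩, ⟨c₂, rfl⟩, ⟨c₃, rfl⟩⟩ := dvd_of_pow_four_dvd D f hf hdvd
  refine ⟨AdjoinRoot.of _ c₀ + AdjoinRoot.of _ c₁ * AdjoinRoot.root _ +
      AdjoinRoot.of _ c₂ * AdjoinRoot.root _ ^ 2 + AdjoinRoot.of _ c₃ * AdjoinRoot.root _ ^ 3, ?_⟩
  rw [eq_div_iff hbL, ← map_mul]
  congr 1
  have hb3 : b ^ 3 ≠ 0 := pow_ne_zero 3 hb0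
  apply mul_right_cancel₀ hb3
  rw [hp, mul_assoc, show b * b ^ 3 = AdjoinRoot.of _ β from (pow_succ' b 3).symm.trans hβ]
  simp only [map_mul]
  ring

end Normal

end QuarticExtension

/-! ### Normality of the affine charts -/

open MvPolynomial in
/-- Evaluation of a homogeneous polynomial at a multiple of a point. -/
lemma MvPolynomial.IsHomogeneous.aeval_mul {σ R T : Type*} [CommSemiring R] [CommSemiring T]
    [Algebra R T] {n : ℕ} {F : MvPolynomial σ R} (hF : F.IsHomogeneous n) (c : T) (x : σ → T) :
    MvPolynomial.aeval (fun i => c * x i) F = c ^ n * MvPolynomial.aeval x F := by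
  rw [aeval_def, aeval_def, eval₂_eq, eval₂_eq, Finset.mul_sum]
  refine Finset.sum_congr rfl fun d hd => ?_
  have hdeg : ∑ i ∈ d.support, d i = n := hF.degree_eq_sum_deg_support hd |>.symm
  simp only [mul_pow, Finset.prod_mul_distrib, Finset.prod_pow_eq_pow_sum, hdeg]
  ring

/-- A retract of a normal domain is a normal domain. -/
theorem isIntegrallyClosed_of_retract {R T : Type*} [CommRing R] [CommRing T] [IsDomain T]
    [IsIntegrallyClosed T] (θ : R →+* T) (ρ : T →+* R) (h : ∀ r, ρ (θ r) = r) :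
    IsDomain R ∧ IsIntegrallyClosed R := by
  have hinj : Function.Injective θ := Function.LeftInverse.injective h
  have hdom : IsDomain R := hinj.isDomain θ
  refine ⟨hdom, (isIntegrallyClosed_iff (FractionRing R)).mpr fun {x} hx => ?_⟩
  let ι : FractionRing R →+* FractionRing T := IsFractionRing.map hinj
  have hι : ∀ r, ι (algebraMap R _ r) = algebraMap T _ (θ r) := fun r => IsLocalization.map_eq _ r
  have hint : IsIntegral T (ι x) := hx.map_of_comp_eq θ ι (RingHom.ext fun r => (hι r).symm)
  obtain ⟨t, ht⟩ := IsIntegrallyClosed.isIntegral_iff.mp hint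
  obtain ⟨a, b, hb, rfl⟩ := IsFractionRing.div_surjective (A := R) x
  have hb0 : b ≠ 0 := nonZeroDivisors.ne_zero hb
  have hbT : algebraMap T (FractionRing T) (θ b) ≠ 0 := by
    rwa [Ne, map_eq_zero_iff _ (IsFractionRing.injective T _), map_eq_zero_iff _ hinj]
  have hbR : algebraMap R (FractionRing R) b ≠ 0 := by
    rwa [Ne, map_eq_zero_iff _ (IsFractionRing.injective R _)]
  rw [map_div₀, hι, hι, eq_div_iff hbT, ← map_mul] at ht
  have := congrArg ρ (IsFractionRing.injective T _ ht)
  rw [map_mul, h, h] at this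
  exact ⟨ρ t, by rw [eq_div_iff hbR, ← map_mul, this]⟩

namespace QuarticSurface

open MvPolynomial

variable {K : Type*} [Field K]

lemma isNormalRing_of_isIntegrallyClosed {R : Type*} [CommRing R] [IsDomain R]
    [IsIntegrallyClosed R] : IsNormalRing R := fun p _ =>
  ⟨IsLocalization.isDomain_localization p.primeCompl_le_nonZeroDivisors,
    isIntegrallyClosed_of_isLocalization _ p.primeCompl p.primeCompl_le_nonZeroDivisors⟩

lemma aeval_dehomogenize {T : Type*} [CommRing T] [Algebra K T] (i : Fin 4)
    (F : MvPolynomial (Fin 4) K) (x : Fin 3 → T) :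
    aeval x (dehomogenize i F) = aeval (i.insertNth (1 : T) x) F := by
  refine (comp_aeval_apply (i.insertNth (1 : MvPolynomial (Fin 3) K) X) (aeval x) F).trans ?_
  congr 2
  ext k
  refine Fin.succAboveCases i ?_ (fun j => ?_) k <;> simp

lemma aeval_quartic {T : Type*} [CommRing T] [Algebra K T] (B : MvPolynomial (Fin 3) K)
    (x : Fin 4 → T) :
    aeval x (quartic B) = x 3 ^ 4 + aeval (fun j : Fin 3 => x j.castSucc) B := by
  rw [quartic, map_add, map_pow, aeval_X, aeval_rename]
  rfl

lemma isHomogeneous_quartic {B : MvPolynomial (Fin 3) K} (hB : B.IsHomogeneous 4) :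
    (quartic B).IsHomogeneous 4 :=
  (isHomogeneous_X_pow 3 4).add hB.rename_isHomogeneous

/-- The charts are retracts of localizations of the normal domain `K[x₁, x₂, x₃][z]/(z⁴ - B)`. -/
theorem isNormalSurface_quartic [CharP K 2] {B : MvPolynomial (Fin 3) K} (hB : B.IsHomogeneous 4)
    (hcop : ∀ d, (∀ j, d ∣ pderiv j B) → IsUnit d) : IsNormalSurface (quartic B) := by
  intro i
  let D : Fin 3 → Derivation ℤ (MvPolynomial (Fin 3) K) (MvPolynomial (Fin 3) K) :=
    fun j => (pderiv j).restrictScalars ℤ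
  let R := AdjoinRoot (Polynomial.X ^ 4 - Polynomial.C B)
  have hdom : IsDomain R := QuarticExtension.isDomain D B hcop
  have hnorm : IsIntegrallyClosed R := QuarticExtension.isIntegrallyClosed D B hcop
  have hroot : (AdjoinRoot.root _ : R) ^ 4 = AdjoinRoot.of _ B := QuarticExtension.root_pow_four B
  have hB0 : B ≠ 0 := by
    rintro rfl
    exact not_isUnit_zero (hcop 0 fun j => by simp)
  let ξ : Fin 4 → R := Fin.snoc (fun j : Fin 3 => (AdjoinRoot.of _ (X j) : R)) (AdjoinRoot.root _)
  have hξc : ∀ j : Fin 3, ξ j.castSucc = AdjoinRoot.of _ (X j) := fun j => Fin.snoc_castSucc _ _ _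
  have hξ3 : ξ 3 = AdjoinRoot.root _ := Fin.snoc_last _ _
  have hξ0 : ξ i ≠ 0 := by
    refine Fin.lastCases ?_ (fun j => ?_) i
    · intro h
      rw [show ξ (Fin.last 3) = AdjoinRoot.root _ from hξ3] at h
      rw [h, zero_pow four_ne_zero, eq_comm,
        map_eq_zero_iff _ (QuarticExtension.of_injective B)] at hroot
      exact hB0 hroot
    · rw [hξc, Ne, map_eq_zero_iff _ (QuarticExtension.of_injective B)]
      exact X_ne_zero j
  have hofaeval : ∀ P : MvPolynomial (Fin 3) K,
      aeval (fun j => (AdjoinRoot.of _ (X j) : R)) P = AdjoinRoot.of _ P := by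
    intro P
    have : (aeval (fun j => (AdjoinRoot.of _ (X j) : R))) =
        AdjoinRoot.ofAlgHom K (Polynomial.X ^ 4 - Polynomial.C B) :=
      algHom_ext fun j => by simp
    rw [this]
    rfl
  have htwo : ∀ r : R, r + r = 0 := by
    have := charP_of_injective_ringHom (QuarticExtension.of_injective B) 2
    exact CharTwo.add_self_eq_zero
  have hξF : aeval ξ (quartic B) = 0 := by
    rw [aeval_quartic, hξ3, hroot]
    simp only [hξc]
    rw [hofaeval, htwo]
  let T := Localization.Away (ξ i)
  have hle : Submonoid.powers (ξ i) ≤ nonZeroDivisors R :=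
    powers_le_nonZeroDivisors_of_noZeroDivisors hξ0
  have : IsDomain T := IsLocalization.isDomain_localization hle
  have : IsIntegrallyClosed T := isIntegrallyClosed_of_isLocalization T _ hle
  let u : T := IsLocalization.Away.invSelf (ξ i)
  have hu : u * algebraMap R T (ξ i) = 1 := by
    rw [mul_comm]; exact IsLocalization.Away.mul_invSelf (ξ i)
  let θ₀ : MvPolynomial (Fin 3) K →ₐ[K] T := aeval fun j => u * algebraMap R T (ξ (i.succAbove j))
  have hθ₀ : θ₀ (dehomogenize i (quartic B)) = 0 := by
    have hins : (i.insertNth (1 : T) fun j => u * algebraMap R T (ξ (i.succAbove j)) : Fin 4 → T) =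
        fun k => u * algebraMap R T (ξ k) := by
      ext k
      refine Fin.succAboveCases i ?_ (fun j => ?_) k
      · simp [hu]
      · simp
    change aeval _ _ = (0 : T)
    rw [aeval_dehomogenize, hins, (isHomogeneous_quartic hB).aeval_mul,
      show aeval (fun k => algebraMap R T (ξ k)) (quartic B) = algebraMap R T (aeval ξ (quartic B))
        from aeval_algebraMap_apply T ξ _, hξF, map_zero, mul_zero]
  -- the section `θ` of the retraction `ρ` sends the coordinate `x_j` to `ξ_j / ξ_i`
  let θ : ChartRing (quartic B) i →+* T := Ideal.Quotient.lift _ θ₀.toRingHom (by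
    intro a ha
    obtain ⟨c, rfl⟩ := Ideal.mem_span_singleton.mp ha
    change θ₀ _ = 0
    rw [map_mul, hθ₀, zero_mul])
  -- `ρ` sets the homogeneous coordinate `ξ_i` equal to one
  let η : Fin 4 → ChartRing (quartic B) i := fun k =>
    Ideal.Quotient.mk _ ((i.insertNth (1 : MvPolynomial (Fin 3) K) X : Fin 4 → _) k)
  have hηF : aeval η (quartic B) = 0 := by
    have : aeval η (quartic B) = Ideal.Quotient.mk _ (dehomogenize i (quartic B)) :=
      (comp_aeval_apply (i.insertNth (1 : MvPolynomial (Fin 3) K) X)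
        (Ideal.Quotient.mkₐ K (Ideal.span {dehomogenize i (quartic B)})) _).symm
    rw [this, Ideal.Quotient.eq_zero_iff_mem]
    exact Ideal.mem_span_singleton_self _
  let σ : MvPolynomial (Fin 3) K →ₐ[K] ChartRing (quartic B) i := aeval fun j => η j.castSucc
  let ρ₀ : R →+* ChartRing (quartic B) i := AdjoinRoot.lift σ.toRingHom (η 3) (by
    rw [aeval_quartic] at hηF
    have h2 : (2 : ChartRing (quartic B) i) = 0 := by
      rw [← map_ofNat (algebraMap K _) 2, CharTwo.two_eq_zero, map_zero]
    simp only [Polynomial.eval₂_sub, Polynomial.eval₂_pow, Polynomial.eval₂_X, Polynomial.eval₂_C]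
    change η 3 ^ 4 - σ B = 0
    linear_combination hηF - σ B * h2)
  have hρξ : ∀ k, ρ₀ (ξ k) = η k := by
    intro k
    refine Fin.lastCases ?_ (fun j => ?_) k
    · rw [show ξ (Fin.last 3) = AdjoinRoot.root _ from hξ3]
      exact AdjoinRoot.lift_root _
    · rw [hξc]
      exact (AdjoinRoot.lift_of _).trans (aeval_X _ _)
  have hη1 : η i = 1 := by simp [η]
  let ρ : T →+* ChartRing (quartic B) i := IsLocalization.Away.lift (ξ i) (g := ρ₀) (by
    rw [hρξ, hη1]; exact isUnit_one)
  have hρR : ∀ r, ρ (algebraMap R T r) = ρ₀ r := fun r => IsLocalization.Away.lift_eq _ _ r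
  have hρu : ρ u = 1 := by
    have := congrArg ρ hu
    rwa [map_mul, hρR, hρξ, hη1, mul_one, map_one] at this
  have hcomp : ρ.comp θ = RingHom.id _ := by
    refine Ideal.Quotient.ringHom_ext (MvPolynomial.ringHom_ext (fun c => ?_) fun j => ?_)
    · change ρ (θ₀ (C c)) = Ideal.Quotient.mk _ (C c)
      rw [show θ₀ (C c) = algebraMap K T c from θ₀.commutes c,
        IsScalarTower.algebraMap_apply K R T, hρR]
      change ρ₀ (AdjoinRoot.of _ (C c)) = _
      exact (AdjoinRoot.lift_of _).trans (σ.commutes c)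
    · change ρ (θ₀ (X j)) = Ideal.Quotient.mk _ (X j)
      rw [show θ₀ (X j) = _ from aeval_X _ j, map_mul, hρu, hρR, hρξ, one_mul]
      simp [η]
  obtain ⟨h1, h2⟩ := isIntegrallyClosed_of_retract θ ρ fun r => RingHom.congr_fun hcomp r
  exact isNormalRing_of_isIntegrallyClosed

end QuarticSurface

/-! ### Quartic forms modulo squares -/

namespace QuarticSurface

open MvPolynomial

variable {K : Type*} [Field K]

/-- The linear form with coefficient vector `c`. -/
noncomputable def linForm (c : Fin 3 → K) : MvPolynomial (Fin 3) K := ∑ j, C (c j) * X j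

/-- The exponent of the monomial `x_{i+1} x_{i+2} x_j²` (indices modulo 3). -/
noncomputable def oddExp (i j : Fin 3) : Fin 3 →₀ ℕ :=
  Finsupp.single (i + 1) 1 + Finsupp.single (i + 2) 1 + Finsupp.single j 2

/-- The quartic form `q² + ∑ᵢ x_{i+1} x_{i+2} lᵢ²`, where the coefficients of the linear form `lᵢ`
are the `i`-th row of the matrix `L`. -/
noncomputable def formOf (q : MvPolynomial (Fin 3) K) (L : Matrix (Fin 3) (Fin 3) K) :
    MvPolynomial (Fin 3) K :=
  q ^ 2 + ∑ i : Fin 3, X (i + 1) * X (i + 2) * linForm (L i) ^ 2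

lemma oddExp_apply (i j k : Fin 3) :
    oddExp i j k = (if i + 1 = k then 1 else 0) + (if i + 2 = k then 1 else 0) +
      (if j = k then 2 else 0) := by
  simp [oddExp, Finsupp.single_apply]

lemma odd_oddExp_iff (i j k : Fin 3) : Odd (oddExp i j k) ↔ k ≠ i := by
  rw [oddExp_apply]
  fin_cases i <;> fin_cases j <;> fin_cases k <;> decide

lemma oddExp_injective {i j i' j' : Fin 3} (h : oddExp i j = oddExp i' j') : i = i' ∧ j = j' := by
  have h' : ∀ k, oddExp i j k = oddExp i' j' k := fun k => by rw [h]
  simp only [oddExp_apply] at h'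
  clear h
  revert i j i' j'
  decide

lemma degree_oddExp (i j : Fin 3) : (oddExp i j).degree = 4 := by
  simp [oddExp]

/-- A quartic monomial in three variables is a square, or exactly two of its exponents are odd. -/
lemma even_or_eq_oddExp (m : Fin 3 →₀ ℕ) (hm : m.degree = 4) :
    (∃ n, m = 2 • n) ∨ ∃ i j, m = oddExp i j := by
  have hsum : m 0 + m 1 + m 2 = 4 := by
    rw [← hm, Finsupp.degree_eq_sum, Fin.sum_univ_three]
  by_cases h : ∀ k, Even (m k)
  · left
    refine ⟨Finsupp.equivFunOnFinite.symm fun k => m k / 2, Finsupp.ext fun k => ?_⟩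
    have := Nat.two_mul_div_two_of_even (h k)
    simp [this]
  · right
    have key : ∃ i j : Fin 3, ∀ k, m k = oddExp i j k := by
      simp only [oddExp_apply]
      have h0 : ¬ (Even (m 0) ∧ Even (m 1) ∧ Even (m 2)) := fun hh => h fun k => by
        fin_cases k
        exacts [hh.1, hh.2.1, hh.2.2]
      simp only [Fin.forall_fin_succ, Fin.exists_fin_succ, IsEmpty.forall_iff]
      clear h hm
      generalize m 0 = a at *
      generalize hb : m 1 = b at *
      generalize hc : m 2 = c at *
      have : a ≤ 4 := by omega
      have : b ≤ 4 := by omega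
      obtain rfl : c = 4 - a - b := by omega
      interval_cases a <;> interval_cases b <;> simp_all +decide
    obtain ⟨i, j, hk⟩ := key
    exact ⟨i, j, Finsupp.ext hk⟩

lemma linForm_add (c d : Fin 3 → K) : linForm (c + d) = linForm c + linForm d := by
  simp [linForm, add_mul, Finset.sum_add_distrib]

variable [CharP K 2]

lemma formOf_add (q q' : MvPolynomial (Fin 3) K) (L L' : Matrix (Fin 3) (Fin 3) K) :
    formOf (q + q') (L + L') = formOf q L + formOf q' L' := by
  have : ∀ i, linForm ((L + L') i) = linForm (L i) + linForm (L' i) := fun i => linForm_add _ _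
  simp only [formOf, this, CharTwo.add_sq, mul_add, Finset.sum_add_distrib]
  ring

/-- Over a perfect field of characteristic two, every quartic form is of the shape `formOf q L`,
and the squares of the entries of `L` are among its coefficients. -/
theorem exists_eq_formOf [IsAlgClosed K] {B : MvPolynomial (Fin 3) K} (hB : B.IsHomogeneous 4) :
    ∃ q L, B = formOf q L ∧ ∀ i j, coeff (oddExp i j) B = L i j ^ 2 := by
  classical
  have hmon : ∀ m ∈ B.support, ∃ q L, monomial m (coeff m B) = formOf q L ∧
      ∀ i j, coeff (oddExp i j) (monomial m (coeff m B)) = L i j ^ 2 := by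
    intro m hm
    have hdeg : m.degree = 4 := by
      by_contra h
      exact mem_support_iff.mp hm (hB.coeff_eq_zero h)
    obtain ⟨c, hc⟩ := IsAlgClosed.exists_pow_nat_eq (coeff m B) (n := 2) two_pos
    rw [← hc]
    rcases even_or_eq_oddExp m hdeg with ⟨n, rfl⟩ | ⟨i₀, j₀, rfl⟩
    · refine ⟨monomial n c, 0, ?_, fun i j => ?_⟩
      · have h0 : ∀ i, linForm ((0 : Matrix (Fin 3) (Fin 3) K) i) = 0 := fun i => by simp [linForm]
        simp [formOf, h0, monomial_pow]
      · rw [coeff_monomial, if_neg]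
        · simp
        · intro h
          have h1 := (odd_oddExp_iff i j (i + 1)).mpr (by fin_cases i <;> decide)
          rw [← h] at h1
          exact Nat.not_odd_iff_even.mpr (even_two_mul _) (by simpa using h1)
    · refine ⟨0, Matrix.single i₀ j₀ c, ?_, fun i j => ?_⟩
      · have h1 : ∀ i, linForm (Matrix.single i₀ j₀ c i) =
            if i = i₀ then C c * X j₀ else 0 := by
          intro i
          by_cases hi : i = i₀
          · subst hi
            simp [linForm, Matrix.single_apply, apply_ite C, ite_mul]
          · simp [linForm, hi, Ne.symm hi]
        simp only [formOf, h1]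
        rw [Finset.sum_eq_single i₀ (fun i _ hi => by simp [hi]) (by simp)]
        simp only [if_true, oddExp]
        rw [show (0 : MvPolynomial (Fin 3) K) ^ 2 = 0 by simp, zero_add, mul_pow, ← C_pow,
          X_pow_eq_monomial, X, X, C_mul_monomial, monomial_mul, monomial_mul]
        simp
      · rw [coeff_monomial, Matrix.single_apply]
        by_cases h : i₀ = i ∧ j₀ = j
        · rw [if_pos h, if_pos (by rw [h.1, h.2])]
        · rw [if_neg h, if_neg fun h' => h (oddExp_injective h'), zero_pow two_ne_zero]
  rw [← support_sum_monomial_coeff B]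
  refine Finset.sum_induction _ (fun P => ∃ q L, P = formOf q L ∧
    ∀ i j, coeff (oddExp i j) P = L i j ^ 2) ?_ ⟨0, 0, ?_, ?_⟩ hmon
  · rintro _ _ ⟨q, L, rfl, h⟩ ⟨q', L', rfl, h'⟩
    refine ⟨q + q', L + L', (formOf_add _ _ _ _).symm, fun i j => ?_⟩
    rw [coeff_add, h, h', Matrix.add_apply, CharTwo.add_sq]
  · have h0 : ∀ i, linForm ((0 : Matrix (Fin 3) (Fin 3) K) i) = 0 := fun i => by simp [linForm]
    simp [formOf, h0]
  · simp

lemma pderiv_sq (k : Fin 3) (P : MvPolynomial (Fin 3) K) : pderiv k (P ^ 2) = 0 := by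
  rw [Derivation.leibniz_pow]
  simp [CharTwo.two_eq_zero]

/-- The partial derivatives of `formOf q L` are the entries of the cross product of `x` and
`(l₀², l₁², l₂²)`. -/
lemma pderiv_formOf (q : MvPolynomial (Fin 3) K) (L : Matrix (Fin 3) (Fin 3) K) (k : Fin 3) :
    pderiv k (formOf q L) =
      X (k + 1) * linForm (L (k + 2)) ^ 2 + X (k + 2) * linForm (L (k + 1)) ^ 2 := by
  rw [formOf, map_add, pderiv_sq, zero_add, map_sum, Fin.sum_univ_three]
  simp only [Derivation.leibniz, pderiv_sq, zero_add, smul_eq_mul, pderiv_X]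
  fin_cases k <;> simp <;> ring

/-- The Frobenius-semilinear map `x ↦ (l₀(x)², l₁(x)², l₂(x)²)` attached to `formOf q L`. -/
noncomputable def sqMap (L : Matrix (Fin 3) (Fin 3) K) :
    (Fin 3 → K) →ₛₗ[frobenius K 2] (Fin 3 → K) where
  toFun x i := L.mulVec x i ^ 2
  map_add' x y := by
    ext i
    simp [Matrix.mulVec_add, CharTwo.add_sq]
  map_smul' c x := by
    ext i
    simp [Matrix.mulVec_smul, mul_pow, frobenius_def]

omit [CharP K 2] in
lemma eval_linForm (c x : Fin 3 → K) : eval x (linForm c) = c ⬝ᵥ x := by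
  simp [linForm, dotProduct]

lemma sqMap_apply (L : Matrix (Fin 3) (Fin 3) K) (x : Fin 3 → K) (i : Fin 3) :
    sqMap L x i = eval x (linForm (L i)) ^ 2 := by
  rw [eval_linForm]
  rfl

lemma mem_ker_sqMap (L : Matrix (Fin 3) (Fin 3) K) (x : Fin 3 → K) :
    x ∈ LinearMap.ker (sqMap L) ↔ x ∈ LinearMap.ker L.mulVecLin := by
  rw [LinearMap.mem_ker, LinearMap.mem_ker, Matrix.mulVecLin_apply, funext_iff, funext_iff]
  exact forall_congr' fun i => pow_eq_zero_iff two_ne_zero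

lemma ker_sqMap (L : Matrix (Fin 3) (Fin 3) K) :
    LinearMap.ker (sqMap L) = LinearMap.ker L.mulVecLin :=
  Submodule.ext (mem_ker_sqMap L)

end QuarticSurface

/-! ### Coprimality of the partial derivatives -/

namespace QuarticSurface

open MvPolynomial Module

variable {K : Type*} [Field K]

/-- Linear forms with a common irreducible factor are proportional. -/
lemma linForm_proportional {π : MvPolynomial (Fin 3) K} (hπ : Irreducible π) {c c' : Fin 3 → K}
    (h : π ∣ linForm c) (h' : π ∣ linForm c') (x x' : Fin 3 → K) :
    (c ⬝ᵥ x) * (c' ⬝ᵥ x') = (c ⬝ᵥ x') * (c' ⬝ᵥ x) := by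
  have hπdeg : π.totalDegree ≠ 0 := by
    intro h0
    rw [totalDegree_eq_zero_iff_eq_C] at h0
    refine hπ.not_isUnit ?_
    rw [h0]
    refine (isUnit_iff_ne_zero.mpr fun hc => hπ.ne_zero ?_).map C
    rw [h0, hc, C_0]
  have key : ∀ c : Fin 3 → K, π ∣ linForm c → ∃ a : K, ∀ x, c ⬝ᵥ x = eval x π * a := by
    rintro c ⟨u, hu⟩
    rcases eq_or_ne u 0 with rfl | hu0
    · exact ⟨0, fun x => by rw [← eval_linForm, hu]; simp⟩
    · have hdeg : (linForm c).totalDegree ≤ 1 :=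
        totalDegree_finsetSum_le fun j _ => (isHomogeneous_C_mul_X _ _).totalDegree_le
      rw [hu, totalDegree_mul_of_isDomain hπ.ne_zero hu0] at hdeg
      have hu' := totalDegree_eq_zero_iff_eq_C.mp (show u.totalDegree = 0 by omega)
      exact ⟨coeff 0 u, fun x => by rw [← eval_linForm, hu, hu']; simp⟩
  obtain ⟨a, ha⟩ := key c h
  obtain ⟨a', ha'⟩ := key c' h'
  rw [ha, ha, ha', ha']
  ring

variable [IsAlgClosed K] [CharP K 2]

lemma exists_fixed_basis {L : Matrix (Fin 3) (Fin 3) K} (hL : Function.Injective (sqMap L)) :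
    ∃ b : Basis (Fin 3) K (Fin 3 → K), ∀ i, sqMap L (b i) = b i := by
  have hspan := FrobeniusSemilinear.span_fixed_eq_top (sqMap L) hL
  have : Finite ((linearIndepOn_empty K id).extend (Set.empty_subset {w | sqMap L w = w})) :=
    Module.Finite.finite_basis (Basis.ofSpan hspan.ge)
  let e := Finite.equivFinOfCardEq
    ((Module.finrank_eq_nat_card_basis (Basis.ofSpan hspan.ge)).symm.trans (finrank_fin_fun K))
  refine ⟨(Basis.ofSpan hspan.ge).reindex e, fun i => ?_⟩
  rw [Basis.reindex_apply]
  exact Basis.ofSpan_subset hspan.ge ⟨_, rfl⟩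

/-- In coordinates `yᵢ` dual to a basis of vectors fixed by `sqMap L`, the form becomes
`y₀y₁y₂(y₀ + y₁ + y₂)` up to squares, and the ideal of its partial derivatives contains all
`yᵢyⱼ(yᵢ + yⱼ)`. -/
theorem isUnit_of_dvd_pderiv (q : MvPolynomial (Fin 3) K) {L : Matrix (Fin 3) (Fin 3) K}
    (hL : Function.Injective (sqMap L)) (d : MvPolynomial (Fin 3) K)
    (hd : ∀ k, d ∣ pderiv k (formOf q L)) : IsUnit d := by
  obtain ⟨b, hb⟩ := exists_fixed_basis hL
  set β : Fin 3 → Fin 3 → K := fun p k => b.coord p (Pi.single k 1) with hβ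
  have hβx : ∀ p x, β p ⬝ᵥ x = b.coord p x := by
    intro p x
    rw [LinearMap.pi_apply_eq_sum_univ (b.coord p) x]
    refine Finset.sum_congr rfl fun k _ => ?_
    rw [smul_eq_mul, mul_comm]
    exact congrArg (x k * b.coord p ·) (funext fun j => by simp [Pi.single_apply, eq_comm])
  have hβb : ∀ p i, β p ⬝ᵥ b i = if i = p then 1 else 0 := by
    intro p i
    rw [hβx, Basis.coord_apply, Basis.repr_self, Finsupp.single_apply]
  -- the dual coordinates of `φ(x)` are the squares of those of `x`
  have hsq : ∀ p x, b.coord p (sqMap L x) = b.coord p x ^ 2 := by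
    intro p x
    conv_lhs => rw [← b.sum_repr x, map_sum, map_sum]
    rw [Finset.sum_eq_single p]
    · rw [map_smulₛₗ, hb, map_smul, Basis.coord_apply, Basis.coord_apply, Basis.repr_self]
      simp [frobenius_def]
    · intro i _ hi
      rw [map_smulₛₗ, hb, map_smul, Basis.coord_apply, Basis.repr_self]
      simp [hi]
    · simp
  have hl : ∀ p, ∑ k, C (β p k) * linForm (L k) ^ 2 = linForm (β p) ^ 2 := by
    intro p
    refine MvPolynomial.funext fun x => ?_
    rw [map_pow, eval_linForm, hβx, ← hsq, ← hβx]
    simp [dotProduct, sqMap_apply]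
  have hcross : ∀ k m, d ∣ X k * linForm (L m) ^ 2 + X m * linForm (L k) ^ 2 := by
    intro k m
    have h0 := hd 0
    have h1 := hd 1
    have h2 := hd 2
    rw [pderiv_formOf] at h0 h1 h2
    simp only [show (1 : Fin 3) + 1 = 2 from rfl, show (1 : Fin 3) + 2 = 0 from rfl,
      show (2 : Fin 3) + 1 = 0 from rfl, show (2 : Fin 3) + 2 = 1 from rfl, zero_add] at h0 h1 h2
    have hself : ∀ k, d ∣ X k * linForm (L k) ^ 2 + X k * linForm (L k) ^ 2 := fun k => by
      rw [CharTwo.add_self_eq_zero]; exact dvd_zero d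
    have hcases : ∀ k : Fin 3, k = 0 ∨ k = 1 ∨ k = 2 := by decide
    rcases hcases k with rfl | rfl | rfl <;> rcases hcases m with rfl | rfl | rfl
    exacts [hself 0, h2, by rw [add_comm]; exact h1, by rw [add_comm]; exact h2, hself 1, h0, h1,
      by rw [add_comm]; exact h0, hself 2]
  have hdy : ∀ p r, d ∣ linForm (β p) * linForm (β r) * (linForm (β p) + linForm (β r)) := by
    intro p r
    have hsum : linForm (β p) * linForm (β r) * (linForm (β p) + linForm (β r)) =
        ∑ k, ∑ m, C (β p k) * C (β r m) *
          (X k * linForm (L m) ^ 2 + X m * linForm (L k) ^ 2) := by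
      have h1 : ∑ k, ∑ m, C (β p k) * C (β r m) * (X k * linForm (L m) ^ 2) =
          linForm (β p) * linForm (β r) ^ 2 := by
        rw [← hl r, linForm, Finset.sum_mul_sum]
        exact Finset.sum_congr rfl fun k _ => Finset.sum_congr rfl fun m _ => by ring
      have h2 : ∑ k, ∑ m, C (β p k) * C (β r m) * (X m * linForm (L k) ^ 2) =
          linForm (β p) ^ 2 * linForm (β r) := by
        rw [← hl p, linForm, Finset.sum_mul_sum]
        exact Finset.sum_congr rfl fun k _ => Finset.sum_congr rfl fun m _ => by ring
      simp only [mul_add, Finset.sum_add_distrib, h1, h2]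
      ring
    rw [hsum]
    exact Finset.dvd_sum fun k _ => Finset.dvd_sum fun m _ => (hcross k m).mul_left _
  by_contra hunit
  obtain ⟨π, hπ, hπd⟩ : ∃ π : MvPolynomial (Fin 3) K, Irreducible π ∧ ∀ P, d ∣ P → π ∣ P := by
    rcases eq_or_ne d 0 with rfl | hd0
    · exact ⟨X 0, X_prime.irreducible, fun P hP => by rw [zero_dvd_iff.mp hP]; exact dvd_zero _⟩
    · obtain ⟨π, hπ, hπd⟩ := WfDvdMonoid.exists_irreducible_factor hunit hd0
      exact ⟨π, hπ, fun P hP => hπd.trans hP⟩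
  have hor : ∀ p r, π ∣ linForm (β p) ∨ π ∣ linForm (β r) ∨ π ∣ linForm (β p + β r) := by
    intro p r
    rcases hπ.prime.dvd_or_dvd (hπd _ (hdy p r)) with h | h
    · exact (hπ.prime.dvd_or_dvd h).imp_right Or.inl
    · exact Or.inr (Or.inr (by rwa [linForm_add]))
  have hno : ∀ p r, p ≠ r → π ∣ linForm (β p) → ¬ π ∣ linForm (β r) := by
    intro p r hpr h h'
    simpa [hβb, hpr, hpr.symm] using linForm_proportional hπ h h' (b p) (b r)
  have hno' : ∀ p r s, p ≠ r → p ≠ s → r ≠ s → π ∣ linForm (β p) →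
      ¬ π ∣ linForm (β r + β s) := by
    intro p r s hpr hps hrs h h'
    simpa [hβb, add_dotProduct, hpr, hpr.symm, hps, hps.symm, hrs, hrs.symm] using
      linForm_proportional hπ h h' (b p) (b r)
  -- no `y_p` is divisible by `π`, so `π` divides both `y₀ + y₁` and `y₀ + y₂`
  have hnone : ∀ p r s, p ≠ r → p ≠ s → r ≠ s → ¬ π ∣ linForm (β p) := by
    intro p r s hpr hps hrs h
    rcases hor r s with h' | h' | h'
    exacts [hno p r hpr h h', hno p s hps h h', hno' p r s hpr hps hrs h h']
  have h0 := hnone 0 1 2 (by decide) (by decide) (by decide)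
  have h1 := hnone 1 0 2 (by decide) (by decide) (by decide)
  have h2 := hnone 2 0 1 (by decide) (by decide) (by decide)
  have h01 := ((hor 0 1).resolve_left h0).resolve_left h1
  have h02 := ((hor 0 2).resolve_left h0).resolve_left h2
  simpa [hβb, add_dotProduct] using linForm_proportional hπ h01 h02 (b 1) (b 2)

end QuarticSurface

/-! ### Singular points as eigenlines -/

namespace QuarticSurface

open MvPolynomial Module
open scoped LinearAlgebra.Projectivization

variable {K : Type*} [Field K] [IsAlgClosed K] [CharP K 2]

omit [IsAlgClosed K] in
lemma pow_four_injective {a b : K} (h : a ^ 4 = b ^ 4) : a = b := by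
  have : (a - b) ^ 4 = 0 := by
    rw [CharTwo.sub_eq_add, show (a + b) ^ 4 = ((a + b) ^ 2) ^ 2 by ring, CharTwo.add_sq,
      CharTwo.add_sq, ← pow_mul, ← pow_mul, h, CharTwo.add_self_eq_zero]
  exact sub_eq_zero.mp (pow_eq_zero_iff four_ne_zero |>.mp this)

omit [IsAlgClosed K] [CharP K 2] in
lemma IsHomogeneous.eval_smul {n : ℕ} {B : MvPolynomial (Fin 3) K} (hB : B.IsHomogeneous n) (c : K)
    (x : Fin 3 → K) : eval (c • x) B = c ^ n * eval x B := by
  have := hB.aeval_mul c x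
  rwa [aeval_eq_eval] at this

omit [IsAlgClosed K] in
/-- The singular points of `z⁴ + B = 0` in terms of the semilinear map attached to `B`. -/
lemma mem_singularPoints_iff {B q : MvPolynomial (Fin 3) K} {L : Matrix (Fin 3) (Fin 3) K}
    (hBL : B = formOf q L) (P : ℙ K (Fin 4 → K)) :
    P ∈ singularPoints (quartic B) ↔
      P.rep 3 ^ 4 = eval (fun j : Fin 3 => P.rep j.castSucc) B ∧
      ∀ k : Fin 3, P.rep (k + 1).castSucc * sqMap L (fun j : Fin 3 => P.rep j.castSucc) (k + 2) =
        P.rep (k + 2).castSucc * sqMap L (fun j : Fin 3 => P.rep j.castSucc) (k + 1) := by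
  rw [singularPoints, Set.mem_ofPred_eq]
  refine and_congr ?_ ?_
  · rw [← aeval_eq_eval, ← aeval_eq_eval]
    change aeval P.rep _ = 0 ↔ _ = aeval _ B
    rw [aeval_quartic, CharTwo.add_eq_zero]
  · have h3 : eval P.rep (pderiv (Fin.last 3) (quartic B)) = 0 := by
      have hvars : pderiv (Fin.last 3) (rename Fin.castSucc B) = 0 := by
        classical
        refine pderiv_eq_zero_of_notMem_vars fun h => ?_
        obtain ⟨j, -, hj⟩ := mem_vars_rename _ _ h
        exact Fin.castSucc_ne_last j hj
      have h4 : (4 : K) = 0 := by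
        rw [show (4 : K) = 2 * 2 by norm_num, CharTwo.two_eq_zero, zero_mul]
      rw [quartic, map_add, hvars, Derivation.leibniz_pow]
      simp [h4]
    have hc : ∀ k : Fin 3, eval P.rep (pderiv k.castSucc (quartic B)) =
        P.rep (k + 1).castSucc * sqMap L (fun j : Fin 3 => P.rep j.castSucc) (k + 2) +
        P.rep (k + 2).castSucc * sqMap L (fun j : Fin 3 => P.rep j.castSucc) (k + 1) := by
      intro k
      rw [quartic, map_add, pderiv_rename (Fin.castSucc_injective 3), hBL, pderiv_formOf,
        Derivation.leibniz_pow, pderiv_X_of_ne (j := 3) (Fin.castSucc_ne_last k).symm]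
      simp only [sqMap_apply]
      simp [eval_rename, Function.comp_def]
    rw [Fin.forall_fin_succ' (n := 3)]
    simp only [h3, hc, and_true, CharTwo.add_eq_zero]

omit [IsAlgClosed K] [CharP K 2] in
lemma exists_eq_smul_of_cross {x y : Fin 3 → K} (hx : x ≠ 0)
    (h : ∀ k : Fin 3, x (k + 1) * y (k + 2) = x (k + 2) * y (k + 1)) : ∃ c : K, y = c • x := by
  obtain ⟨i, hi⟩ := Function.ne_iff.mp hx
  have hi : x i ≠ 0 := hi
  refine ⟨y i / x i, funext fun j => ?_⟩
  have hxy : x i * y j = x j * y i := by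
    have h0 : x 1 * y 2 = x 2 * y 1 := h 0
    have h1 : x 2 * y 0 = x 0 * y 2 := h 1
    have h2 : x 0 * y 1 = x 1 * y 0 := h 2
    have hcases : ∀ k : Fin 3, k = 0 ∨ k = 1 ∨ k = 2 := by decide
    rcases hcases i with rfl | rfl | rfl <;> rcases hcases j with rfl | rfl | rfl <;>
      first | rfl | assumption | (symm; assumption)
  rw [Pi.smul_apply, smul_eq_mul, div_mul_eq_mul_div, eq_div_iff hi]
  linear_combination hxy

/-- The point of the surface `z⁴ + B = 0` above a point of the plane. -/
noncomputable def pointAbove (B : MvPolynomial (Fin 3) K) (w : {w : Fin 3 → K // w ≠ 0}) :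
    ℙ K (Fin 4 → K) :=
  Projectivization.mk K
    (Fin.snoc w.1 (IsAlgClosed.exists_pow_nat_eq (eval w.1 B) (n := 4) four_pos).choose : Fin 4 → K)
    fun h => w.2 (funext fun j => by
      have := congrFun h j.castSucc
      rwa [Fin.snoc_castSucc] at this)

omit [CharP K 2] in
lemma pointAbove_rep (B : MvPolynomial (Fin 3) K) (w : {w : Fin 3 → K // w ≠ 0}) :
    ∃ a : K, a ≠ 0 ∧ (fun j : Fin 3 => (pointAbove B w).rep j.castSucc) = a • w.1 ∧
      (pointAbove B w).rep 3 ^ 4 = a ^ 4 * eval w.1 B := by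
  obtain ⟨a, ha⟩ := Projectivization.exists_smul_eq_mk_rep K
    (Fin.snoc w.1 (IsAlgClosed.exists_pow_nat_eq (eval w.1 B) (n := 4) four_pos).choose : Fin 4 → K)
    (fun h => w.2 (funext fun j => by
      have := congrFun h j.castSucc
      rwa [Fin.snoc_castSucc] at this))
  refine ⟨a, a.ne_zero, funext fun j => ?_, ?_⟩
  · rw [pointAbove, ← ha, Pi.smul_apply, Fin.snoc_castSucc]
    rfl
  · rw [pointAbove, ← ha, Pi.smul_apply, show (3 : Fin 4) = Fin.last 3 from rfl, Fin.snoc_last,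
      Units.smul_def, smul_eq_mul, mul_pow,
      (IsAlgClosed.exists_pow_nat_eq (eval w.1 B) (n := 4) four_pos).choose_spec]

lemma eq_pointAbove {B : MvPolynomial (Fin 3) K} (hB : B.IsHomogeneous 4) {P : ℙ K (Fin 4 → K)}
    (hP : P.rep 3 ^ 4 = eval (fun j : Fin 3 => P.rep j.castSucc) B) {a : K}
    (w : {w : Fin 3 → K // w ≠ 0}) (hw : (fun j : Fin 3 => P.rep j.castSucc) = a • w.1) :
    P = pointAbove B w := by
  rw [← P.mk_rep, pointAbove, Projectivization.mk_eq_mk_iff']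
  refine ⟨a, funext fun k => ?_⟩
  rw [Pi.smul_apply]
  refine Fin.lastCases ?_ (fun j => ?_) k
  · rw [Fin.snoc_last]
    apply pow_four_injective
    rw [smul_eq_mul, mul_pow,
      (IsAlgClosed.exists_pow_nat_eq (eval w.1 B) (n := 4) four_pos).choose_spec,
      ← IsHomogeneous.eval_smul hB, ← hw, ← hP]
    rfl
  · rw [Fin.snoc_castSucc]
    exact (congrFun hw j).symm

omit [IsAlgClosed K] in
/-- The plane coordinates of a singular point form an eigenvector of the semilinear map. -/
lemma exists_eigenvalue {B q : MvPolynomial (Fin 3) K} (hB : B.IsHomogeneous 4)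
    {L : Matrix (Fin 3) (Fin 3) K} (hBL : B = formOf q L) {P : ℙ K (Fin 4 → K)}
    (hP : P ∈ singularPoints (quartic B)) :
    (fun j : Fin 3 => P.rep j.castSucc) ≠ 0 ∧ ∃ c : K,
      sqMap L (fun j : Fin 3 => P.rep j.castSucc) = c • fun j : Fin 3 => P.rep j.castSucc := by
  obtain ⟨h4, hcross⟩ := (mem_singularPoints_iff hBL P).mp hP
  have hx : (fun j : Fin 3 => P.rep j.castSucc) ≠ 0 := by
    intro h0
    rw [h0, ← zero_smul K (0 : Fin 3 → K), IsHomogeneous.eval_smul hB, zero_pow four_ne_zero,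
      zero_mul] at h4
    refine P.rep_nonzero (funext fun k => ?_)
    refine Fin.lastCases ?_ (fun j => congrFun h0 j) k
    exact pow_eq_zero_iff four_ne_zero |>.mp h4
  exact ⟨hx, exists_eq_smul_of_cross hx hcross⟩

/-- The points above fixed vectors are singular. -/
lemma pointAbove_mem {B q : MvPolynomial (Fin 3) K} (hB : B.IsHomogeneous 4)
    {L : Matrix (Fin 3) (Fin 3) K} (hBL : B = formOf q L) (w : {w : Fin 3 → K // w ≠ 0})
    (hw : sqMap L w.1 = w.1) : pointAbove B w ∈ singularPoints (quartic B) := by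
  rw [mem_singularPoints_iff hBL]
  obtain ⟨a, -, hx, hz⟩ := pointAbove_rep B w
  refine ⟨by rw [hz, hx, IsHomogeneous.eval_smul hB], fun k => ?_⟩
  have hx' : ∀ k : Fin 3, (pointAbove B w).rep k.castSucc = a * w.1 k := congrFun hx
  rw [hx, hx', hx', map_smulₛₗ, hw]
  simp only [Pi.smul_apply, smul_eq_mul]
  ring

/-- An eigenvector with nonzero eigenvalue is a multiple of a fixed vector. -/
lemma mem_image_or_mem_ker {B q : MvPolynomial (Fin 3) K} (hB : B.IsHomogeneous 4)
    {L : Matrix (Fin 3) (Fin 3) K} (hBL : B = formOf q L) {P : ℙ K (Fin 4 → K)}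
    (hP : P ∈ singularPoints (quartic B)) :
    P ∈ pointAbove B '' {w | sqMap L w.1 = w.1} ∨
      (fun j : Fin 3 => P.rep j.castSucc) ∈ LinearMap.ker (sqMap L) := by
  have h4 := ((mem_singularPoints_iff hBL P).mp hP).1
  obtain ⟨hx, c, hc⟩ := exists_eigenvalue hB hBL hP
  rcases eq_or_ne c 0 with rfl | hc0
  · right
    rw [LinearMap.mem_ker, hc, zero_smul]
  · left
    refine ⟨⟨c⁻¹ • fun j : Fin 3 => P.rep j.castSucc, smul_ne_zero (inv_ne_zero hc0) hx⟩, ?_, ?_⟩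
    · rw [Set.mem_ofPred_eq, map_smulₛₗ, hc, smul_smul, frobenius_def]
      congr 1
      field_simp
    · refine (eq_pointAbove (a := c) hB h4 _ ?_).symm
      rw [smul_smul, mul_inv_cancel₀ hc0, one_smul]

/-- Two proportional nonzero fixed vectors are equal, since `c² = c` implies `c = 1`. -/
lemma pointAbove_injOn (B : MvPolynomial (Fin 3) K) (L : Matrix (Fin 3) (Fin 3) K) :
    Set.InjOn (pointAbove B) {w | sqMap L w.1 = w.1} := by
  intro w hw w' hw' h
  obtain ⟨a, ha, hx, -⟩ := pointAbove_rep B w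
  obtain ⟨a', ha', hx', -⟩ := pointAbove_rep B w'
  have hw : sqMap L w.1 = w.1 := hw
  have hw' : sqMap L w'.1 = w'.1 := hw'
  rw [h, hx'] at hx
  have e : w.1 = (a⁻¹ * a') • w'.1 := by rw [mul_smul, hx, smul_smul, inv_mul_cancel₀ ha, one_smul]
  set c := a⁻¹ * a'
  have hc0 : c ≠ 0 := mul_ne_zero (inv_ne_zero ha) ha'
  rw [e, map_smulₛₗ, hw', frobenius_def] at hw
  have hc : c ^ 2 = c := smul_left_injective K w'.2 hw
  have hc1 : c = 1 := mul_left_cancel₀ hc0 (by rw [← pow_two, hc, mul_one])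
  exact Subtype.ext (by rw [e, hc1, one_smul])

lemma encard_image_fixed (B : MvPolynomial (Fin 3) K) (L : Matrix (Fin 3) (Fin 3) K) :
    (pointAbove B '' {w | sqMap L w.1 = w.1}).encard + 1 =
      2 ^ finrank K (Submodule.span K {w | sqMap L w = w}) := by
  rw [(pointAbove_injOn B L).encard_image, ← (FrobeniusSemilinear.encard_fixed (sqMap L)).1,
    ← Subtype.val_injective.encard_image]
  have : Subtype.val '' {w : {w : Fin 3 → K // w ≠ 0} | sqMap L w.1 = w.1} =
      {w | sqMap L w = w} \ {0} := by
    ext w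
    simp [and_comm]
  rw [this, Set.encard_sdiff_singleton_add_one]
  simp

theorem encard_singularPoints_of_injective {B q : MvPolynomial (Fin 3) K} (hB : B.IsHomogeneous 4)
    {L : Matrix (Fin 3) (Fin 3) K} (hBL : B = formOf q L) (hL : Function.Injective (sqMap L)) :
    (singularPoints (quartic B)).encard = 7 := by
  have hS : singularPoints (quartic B) = pointAbove B '' {w | sqMap L w.1 = w.1} := by
    refine Set.Subset.antisymm (fun P hP => ?_) ?_
    · refine (mem_image_or_mem_ker hB hBL hP).resolve_right fun h => ?_
      rw [LinearMap.ker_eq_bot.mpr hL] at h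
      exact (exists_eigenvalue hB hBL hP).1 h
    · rintro _ ⟨w, hw, rfl⟩
      exact pointAbove_mem hB hBL w hw
  have h := encard_image_fixed B L
  rw [← hS, FrobeniusSemilinear.span_fixed_eq_top (sqMap L) hL, finrank_top, finrank_fin_fun] at h
  have h8 : (singularPoints (quartic B)).encard + 1 = 7 + 1 := by rw [h]; norm_num
  exact ENat.add_left_injective_of_ne_top ENat.one_ne_top h8

theorem encard_singularPoints_le_of_finrank_ker_eq_one {B q : MvPolynomial (Fin 3) K}
    (hB : B.IsHomogeneous 4) {L : Matrix (Fin 3) (Fin 3) K} (hBL : B = formOf q L)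
    (hL : finrank K (LinearMap.ker (sqMap L)) = 1) :
    (singularPoints (quartic B)).encard ≤ 7 := by
  obtain ⟨⟨k, hk⟩, hk0, hspan⟩ := finrank_eq_one_iff'.mp hL
  have hk0' : k ≠ 0 := fun h => hk0 (Subtype.ext h)
  have hsub : singularPoints (quartic B) ⊆
      pointAbove B '' {w | sqMap L w.1 = w.1} ∪ {pointAbove B ⟨k, hk0'⟩} := by
    intro P hP
    refine (mem_image_or_mem_ker hB hBL hP).imp id fun h => ?_
    obtain ⟨c, hc⟩ := hspan ⟨_, h⟩
    exact eq_pointAbove (a := c) hB ((mem_singularPoints_iff hBL P).mp hP).1 _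
      (congrArg Subtype.val hc).symm
  have hle := (Set.encard_le_encard hsub).trans (Set.encard_union_le _ _)
  rw [Set.encard_singleton, encard_image_fixed] at hle
  have hdim := (FrobeniusSemilinear.encard_fixed (sqMap L)).2
  rw [hL, finrank_fin_fun] at hdim
  refine hle.trans ?_
  calc (2 : ℕ∞) ^ finrank K (Submodule.span K {w | sqMap L w = w}) ≤ 2 ^ 2 :=
        pow_le_pow_right₀ (by norm_num) (by omega)
    _ ≤ 7 := by norm_num

end QuarticSurface

/-! ### Non-normality in the degenerate case -/

namespace QuarticSurface

open MvPolynomial Module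

variable {K : Type*} [Field K] [IsAlgClosed K] [CharP K 2]

omit [IsAlgClosed K] [CharP K 2] in
lemma exists_rank_one {L : Matrix (Fin 3) (Fin 3) K}
    (hL : 2 ≤ finrank K (LinearMap.ker L.mulVecLin)) :
    ∃ v d : Fin 3 → K, ∀ i j, L i j = v i * d j := by
  have hrank := L.mulVecLin.finrank_range_add_finrank_ker
  rw [finrank_fin_fun] at hrank
  obtain ⟨⟨v, _⟩, hv⟩ := finrank_le_one_iff.mp
    (show finrank K (LinearMap.range L.mulVecLin) ≤ 1 by omega)
  choose d hd using fun j : Fin 3 => hv ⟨_, LinearMap.mem_range_self L.mulVecLin (Pi.single j 1)⟩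
  refine ⟨v, d, fun i j => ?_⟩
  have := congrFun (congrArg Subtype.val (hd j)) i
  simp at this
  rw [← this, mul_comm]

omit [IsAlgClosed K] [CharP K 2] in
lemma exists_point_on_line (d : Fin 3 → K) :
    ∃ (x : Fin 3 → K) (i : Fin 3), x i = 1 ∧ d ⬝ᵥ x = 0 := by
  by_cases h : d 0 = 0
  · exact ⟨![1, 0, 0], 0, rfl, by simp [dotProduct, Fin.sum_univ_three, h]⟩
  · refine ⟨![- d 1 / d 0, 1, 0], 1, rfl, ?_⟩
    simp [dotProduct, Fin.sum_univ_three]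
    field_simp
    ring

/-- If the `lᵢ` are multiples of one linear form `l`, the equation reads `(z² + q)² = l² m`. Then
`(z² + q) / l` is integral, but not regular at the points where `l = z² + q = 0`: along the
vertical line through such a point the equation vanishes to order four and `z² + q` to order two
only. -/
theorem not_isNormalSurface (q : MvPolynomial (Fin 3) K) {L : Matrix (Fin 3) (Fin 3) K}
    (hL : 2 ≤ finrank K (LinearMap.ker L.mulVecLin)) :
    ¬ IsNormalSurface (quartic (formOf q L)) := by
  intro hnorm
  obtain ⟨v, d, hvd⟩ := exists_rank_one hL
  obtain ⟨x, i, hxi, hdx⟩ := exists_point_on_line d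
  obtain ⟨z, hz⟩ := IsAlgClosed.exists_pow_nat_eq (eval x q) (n := 2) two_pos
  have hlin : ∀ k, linForm (L k) = C (v k) * linForm d := by
    intro k
    simp only [linForm, hvd, C_mul, Finset.mul_sum, mul_assoc]
  obtain ⟨m, hform⟩ : ∃ m, formOf q L = q ^ 2 + linForm d ^ 2 * m := by
    refine ⟨∑ k : Fin 3, X (k + 1) * X (k + 2) * C (v k) ^ 2, ?_⟩
    simp only [formOf, hlin, Finset.mul_sum]
    exact congrArg (q ^ 2 + ·) (Finset.sum_congr rfl fun k _ => by ring)
  have hF : quartic (formOf q L) = (X 3 ^ 2 + rename Fin.castSucc q) ^ 2 +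
      rename Fin.castSucc (linForm d) ^ 2 * rename Fin.castSucc m := by
    rw [CharTwo.add_sq, hform]
    simp only [quartic, map_add, map_mul, map_pow, ← pow_mul, add_assoc]
  set F := quartic (formOf q L) with hFdef
  -- the vertical line through the point `(x, z)`
  let g : Fin 4 → Polynomial K :=
    Fin.snoc (fun j : Fin 3 => Polynomial.C (x j)) (Polynomial.C z + Polynomial.X)
  have hgc : ∀ j : Fin 3, g j.castSucc = Polynomial.C (x j) := fun j => Fin.snoc_castSucc _ _ _
  have hg3 : g 3 = Polynomial.C z + Polynomial.X := Fin.snoc_last _ _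
  let γ : MvPolynomial (Fin 3) K →ₐ[K] Polynomial K :=
    aeval fun j => g (i.castSucc.succAbove j)
  have hγ : ∀ P, γ (dehomogenize i.castSucc P) = aeval g P := by
    intro P
    rw [show γ (dehomogenize i.castSucc P) = _ from aeval_dehomogenize _ _ _]
    congr 2
    ext1 k
    refine Fin.succAboveCases i.castSucc ?_ (fun j => ?_) k
    · rw [Fin.insertNth_apply_same, hgc, hxi, Polynomial.C_1]
    · rw [Fin.insertNth_apply_succAbove]
  have hγren : ∀ P : MvPolynomial (Fin 3) K,
      γ (dehomogenize i.castSucc (rename Fin.castSucc P)) = Polynomial.C (eval x P) := by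
    intro P
    rw [hγ, aeval_rename, show g ∘ Fin.castSucc = fun j => algebraMap K (Polynomial K) (x j) from
      funext hgc]
    exact aeval_algebraMap_apply (Polynomial K) x P
  let W := dehomogenize i.castSucc (X 3 ^ 2 + rename Fin.castSucc q)
  let l := dehomogenize i.castSucc (rename Fin.castSucc (linForm d))
  have hγl : γ l = 0 := by
    rw [hγren, eval_linForm, hdx, Polynomial.C_0]
  have hγW : γ W = Polynomial.X ^ 2 := by
    have hadd : W = dehomogenize i.castSucc (X 3 ^ 2) +
      dehomogenize i.castSucc (rename Fin.castSucc q) := map_add _ _ _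
    rw [hadd, map_add, hγren, hγ, map_pow, aeval_X, hg3, CharTwo.add_sq, ← hz, Polynomial.C_pow,
      add_right_comm, CharTwo.add_self_eq_zero, zero_add]
  let f := dehomogenize i.castSucc F
  have hf : f = W ^ 2 + l ^ 2 * dehomogenize i.castSucc (rename Fin.castSucc m) := by
    change dehomogenize _ _ = _
    rw [hF]
    simp only [dehomogenize, map_add, map_mul, map_pow, W, l]
  have hγf : γ f = Polynomial.X ^ 4 := by
    rw [hf, map_add, map_mul, map_pow, map_pow, hγl, hγW]
    ring
  -- the point of the surface above `x`, as a prime ideal of the chart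
  let ε : ChartRing F i.castSucc →+* K := Ideal.Quotient.lift _
    ((Polynomial.evalRingHom 0).comp γ.toRingHom) (by
      intro a ha
      obtain ⟨c, rfl⟩ := Ideal.mem_span_singleton.mp ha
      change Polynomial.eval 0 (γ (f * c)) = 0
      rw [map_mul, hγf]
      simp)
  have hε : ∀ P, ε (Ideal.Quotient.mk _ P) = (γ P).eval 0 := fun P => Ideal.Quotient.lift_mk _ _ _
  let p := RingHom.ker ε
  have hp : p.IsPrime := RingHom.ker_isPrime ε
  obtain ⟨hdom, hclosed⟩ := hnorm i.castSucc p
  let α := algebraMap (ChartRing F i.castSucc) (Localization.AtPrime p)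
  let mk := Ideal.Quotient.mk (Ideal.span {dehomogenize i.castSucc F})
  have hdvd : α (mk l) ∣ α (mk W) := by
    rw [← IsIntegrallyClosed.pow_dvd_pow_iff two_ne_zero]
    refine ⟨α (mk (-dehomogenize i.castSucc (rename Fin.castSucc m))), ?_⟩
    have h0 : mk f = 0 := Ideal.Quotient.eq_zero_iff_mem.mpr (Ideal.mem_span_singleton_self _)
    have hW : W ^ 2 = f + l ^ 2 * -dehomogenize i.castSucc (rename Fin.castSucc m) := by
      rw [hf]
      ring
    have := congrArg (fun P => α (mk P)) hW
    simpa only [map_add, map_mul, map_pow, h0, map_zero, zero_add] using this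
  obtain ⟨t, ht⟩ := hdvd
  obtain ⟨⟨a, s⟩, has⟩ := IsLocalization.surj p.primeCompl t
  have heq : α (mk W * s) = α (mk l * a) := by
    rw [map_mul, ht, mul_assoc, map_mul]
    exact congrArg _ has
  obtain ⟨c, hc⟩ := (IsLocalization.eq_iff_exists p.primeCompl _).mp heq
  obtain ⟨s, hs⟩ := s
  obtain ⟨c, hcp⟩ := c
  obtain ⟨a, rfl⟩ := Ideal.Quotient.mk_surjective a
  obtain ⟨s, rfl⟩ := Ideal.Quotient.mk_surjective s
  obtain ⟨c, rfl⟩ := Ideal.Quotient.mk_surjective c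
  have hc' : mk (c * (W * s)) = mk (c * (l * a)) := hc
  obtain ⟨u, hu⟩ := Ideal.mem_span_singleton.mp (Ideal.Quotient.eq.mp hc')
  have hu' : c * (W * s) - c * (l * a) = f * u := hu
  have hγu := congrArg γ hu'
  simp only [map_sub, map_mul, hγl, hγW, hγf] at hγu
  have hcs : γ c * γ s = Polynomial.X ^ 2 * γ u := by
    apply mul_left_cancel₀ (pow_ne_zero 2 (Polynomial.X_ne_zero (R := K)))
    linear_combination hγu
  have h0 : (γ c).eval 0 * (γ s).eval 0 = 0 := by
    rw [← Polynomial.eval_mul, hcs]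
    simp
  rcases mul_eq_zero.mp h0 with h | h
  · exact hcp ((hε c).trans h)
  · exact hs ((hε s).trans h)

end QuarticSurface

/-! ### Formal changes of coordinates -/

namespace MvPowerSeries

open Finsupp

variable {σ R : Type*} [CommRing R]

lemma le_order_add {n : ℕ∞} {f g : MvPowerSeries σ R} (hf : n ≤ f.order) (hg : n ≤ g.order) :
    n ≤ (f + g).order :=
  (le_min hf hg).trans min_order_le_add

lemma le_order_sub {n : ℕ∞} {f g : MvPowerSeries σ R} (hf : n ≤ f.order) (hg : n ≤ g.order) :
    n ≤ (f - g).order := by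
  rw [sub_eq_add_neg]
  exact le_order_add hf (by rwa [order_neg])

lemma le_order_sum {n : ℕ∞} {ι : Type*} (s : Finset ι) (f : ι → MvPowerSeries σ R)
    (h : ∀ i ∈ s, n ≤ (f i).order) : n ≤ (∑ i ∈ s, f i).order :=
  Finset.sum_induction _ (fun g : MvPowerSeries σ R => n ≤ g.order) (fun _ _ => le_order_add)
    (by simp) h

lemma eq_of_forall_le_order_sub {f g : MvPowerSeries σ R} (h : ∀ n : ℕ, n ≤ (f - g).order) :
    f = g := by
  rw [← sub_eq_zero, ← order_eq_top_iff]
  exact ENat.eq_top_iff_forall_ge.mpr h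

/-- An additive endomorphism that is the identity up to terms of higher order is bijective: its
inverse is the geometric series. -/
theorem bijective_of_le_order_sub (φ : MvPowerSeries σ R →+ MvPowerSeries σ R)
    (h : ∀ (n : ℕ) f, n ≤ order f → (n + 1 : ℕ) ≤ order (φ f - f)) : Function.Bijective φ := by
  constructor
  · rw [injective_iff_map_eq_zero]
    intro f hf
    by_contra hne
    have hfin := (ne_zero_iff_order_finite.mp hne)
    have := h f.order.toNat f hfin.le
    rw [hf, zero_sub, order_neg, ← hfin] at this
    exact absurd (Nat.cast_le.mp this) (by simp)
  · intro f
    let r : ℕ → MvPowerSeries σ R := fun n => (fun g => g - φ g)^[n] f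
    have hr : ∀ n, r (n + 1) = r n - φ (r n) := fun n => Function.iterate_succ_apply' _ n f
    have hord : ∀ n : ℕ, n ≤ (r n).order := by
      intro n
      induction n with
      | zero => simp
      | succ n ih =>
        rw [hr, ← order_neg, neg_sub]
        exact h n _ ih
    let g : MvPowerSeries σ R := fun e => coeff e (∑ k ∈ Finset.range (e.degree + 1), r k)
    have hg : ∀ e, coeff e g = ∑ k ∈ Finset.range (e.degree + 1), coeff e (r k) := fun e => by
      rw [coeff_apply, ← map_sum]
    have hgN : ∀ N : ℕ, N ≤ (g - ∑ k ∈ Finset.range N, r k).order := by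
      intro N
      refine nat_le_order fun e he => ?_
      rw [map_sub, hg, map_sum, sub_eq_zero]
      refine Finset.sum_subset (Finset.range_mono he) fun k _ hk => ?_
      refine coeff_of_lt_order (lt_of_lt_of_le ?_ (hord k))
      rw [Finset.mem_range, not_lt] at hk
      exact_mod_cast hk
    have hφ : ∀ N : ℕ, φ (∑ k ∈ Finset.range N, r k) = f - r N := by
      intro N
      induction N with
      | zero => simp [r]
      | succ N ih =>
        rw [Finset.sum_range_succ, map_add, ih, hr]
        abel
    refine ⟨g, eq_of_forall_le_order_sub fun N => ?_⟩
    set d := g - ∑ k ∈ Finset.range N, r k with hd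
    have hgd : φ g - f = (φ d - d) + d - r N := by
      rw [hd, map_sub, hφ]
      abel
    rw [hgd]
    refine le_order_sub (le_order_add (le_trans ?_ (h N d (hgN N))) (hgN N)) (hord N)
    exact_mod_cast Nat.le_succ N

lemma degree_le_order_prod {a : σ → MvPowerSeries σ R} (ha : ∀ i, 1 ≤ (a i).order) (d : σ →₀ ℕ) :
    (d.degree : ℕ∞) ≤ (d.prod fun s e => a s ^ e).order := by
  refine le_trans ?_ (le_order_prod _ _)
  rw [Finsupp.degree_apply, Nat.cast_sum]
  refine Finset.sum_le_sum fun i _ => le_trans ?_ (le_order_pow _)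
  rw [nsmul_eq_mul]
  exact le_mul_of_one_le_right zero_le (ha i)

lemma one_le_order_X (i : σ) : 1 ≤ (X i : MvPowerSeries σ R).order := by
  rw [one_le_order_iff_constCoeff_eq_zero]
  simp

lemma one_le_order_of_sub_X {a : σ → MvPowerSeries σ R} (ha : ∀ i, 2 ≤ (a i - X i).order) (i : σ) :
    1 ≤ (a i).order := by
  have := le_order_add (le_trans (by norm_num) (ha i)) (one_le_order_X (R := R) i)
  rwa [sub_add_cancel] at this

lemma degree_add_one_le_order_prod_sub {a : σ → MvPowerSeries σ R}
    (ha : ∀ i, 2 ≤ (a i - X i).order) (d : σ →₀ ℕ) : ((d.degree + 1 : ℕ) : ℕ∞) ≤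
      ((d.prod fun s e => a s ^ e) - d.prod fun s e => (X s : MvPowerSeries σ R) ^ e).order := by
  classical
  have hadd : ∀ (c : σ → MvPowerSeries σ R) (d e : σ →₀ ℕ), ((d + e).prod fun s e => c s ^ e) =
      (d.prod fun s e => c s ^ e) * e.prod fun s e => c s ^ e := fun c d e =>
    Finsupp.prod_add_index' (fun _ => pow_zero _) fun _ _ _ => pow_add _ _ _
  -- the bound is stable under multiplication of monomials
  have hmul : ∀ (m n : ℕ) (p p' r r' : MvPowerSeries σ R), m ≤ p.order → n ≤ r'.order →
      (m + 1 : ℕ) ≤ (p - p').order → (n + 1 : ℕ) ≤ (r - r').order →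
      (m + n + 1 : ℕ) ≤ (p * r - p' * r').order := by
    intro m n p p' r r' hp hr' hpp hrr
    rw [show p * r - p' * r' = p * (r - r') + (p - p') * r' by ring]
    refine le_order_add (le_trans ?_ le_order_mul) (le_trans ?_ le_order_mul)
    · refine le_trans ?_ (add_le_add hp hrr)
      exact_mod_cast (by omega : m + n + 1 ≤ m + (n + 1))
    · refine le_trans ?_ (add_le_add hpp hr')
      exact_mod_cast (by omega : m + n + 1 ≤ m + 1 + n)
  induction d using Finsupp.induction_linear with
  | zero => simp
  | add d e hd he =>
    rw [hadd, hadd, map_add]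
    exact hmul _ _ _ _ _ _ (degree_le_order_prod (one_le_order_of_sub_X ha) d)
      (degree_le_order_prod one_le_order_X e) hd he
  | single i n =>
    induction n with
    | zero => simp
    | succ n ih =>
      rw [Finsupp.single_add, hadd, hadd, map_add]
      refine hmul _ _ _ _ _ _ (degree_le_order_prod (one_le_order_of_sub_X ha) _)
        (degree_le_order_prod one_le_order_X _) ih ?_
      simpa using ha i

variable [Finite σ]

lemma hasSubst_of_one_le_order {a : σ → MvPowerSeries σ R} (ha : ∀ i, 1 ≤ (a i).order) :
    HasSubst a :=
  hasSubst_of_constantCoeff_zero fun i => one_le_order_iff_constCoeff_eq_zero.mp (ha i)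

/-- Substitutions tangent to the identity are bijective. -/
theorem bijective_subst_of_le_order_sub {a : σ → MvPowerSeries σ R}
    (ha : ∀ i, 2 ≤ (a i - X i).order) :
    Function.Bijective (subst a : MvPowerSeries σ R → MvPowerSeries σ R) := by
  have hsub := hasSubst_of_one_le_order (one_le_order_of_sub_X ha)
  rw [← coe_substAlgHom hsub]
  refine bijective_of_le_order_sub (substAlgHom hsub).toRingHom.toAddMonoidHom fun n f hf => ?_
  change _ ≤ (substAlgHom hsub f - f).order
  rw [substAlgHom_apply]
  refine nat_le_order fun e he => ?_
  rw [map_sub, sub_eq_zero]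
  conv_rhs => rw [← id_eq f, ← subst_self, coeff_subst HasSubst.X]
  rw [coeff_subst hsub]
  refine finsum_congr fun d => ?_
  rcases lt_or_ge d.degree n with hd | hd
  · rw [coeff_of_lt_order (lt_of_lt_of_le (by exact_mod_cast hd) hf), zero_smul, zero_smul]
  · congr 1
    rw [← sub_eq_zero, ← map_sub]
    refine coeff_of_lt_order (lt_of_lt_of_le ?_ (degree_add_one_le_order_prod_sub ha d))
    exact_mod_cast (by omega : e.degree < d.degree + 1)

end MvPowerSeries

namespace MvPowerSeries

variable {σ R : Type*} [CommRing R] [Fintype σ]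

/-- The linear substitution with matrix `M`. -/
noncomputable def linearVec (M : Matrix σ σ R) (i : σ) : MvPowerSeries σ R := ∑ j, C (M i j) * X j

lemma one_le_order_linearVec (M : Matrix σ σ R) (i : σ) : 1 ≤ (linearVec M i).order := by
  rw [one_le_order_iff_constCoeff_eq_zero]
  simp [linearVec]

lemma linearVec_one [DecidableEq σ] : linearVec (1 : Matrix σ σ R) = X := by
  funext i
  rw [linearVec, Finset.sum_eq_single i] <;> simp +contextual [eq_comm]

lemma subst_linearVec {a : σ → MvPowerSeries σ R} (ha : HasSubst a) (M : Matrix σ σ R) (i : σ) :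
    subst a (linearVec M i) = ∑ j, C (M i j) * a j := by
  rw [linearVec, ← substAlgHom_apply ha, map_sum]
  refine Finset.sum_congr rfl fun j _ => ?_
  rw [map_mul, substAlgHom_X, substAlgHom_apply, subst_C]

lemma sum_linearVec (M N : Matrix σ σ R) (i : σ) :
    ∑ j, C (M i j) * linearVec N j = linearVec (M * N) i := by
  simp only [linearVec, Finset.mul_sum, Matrix.mul_apply, map_sum, Finset.sum_mul]
  rw [Finset.sum_comm]
  exact Finset.sum_congr rfl fun j _ => Finset.sum_congr rfl fun k _ => by rw [map_mul, mul_assoc]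

lemma bijective_subst_linearVec [DecidableEq σ] {M : Matrix σ σ R} (hM : IsUnit M.det) :
    Function.Bijective (subst (linearVec M) : MvPowerSeries σ R → MvPowerSeries σ R) := by
  have hcomp : ∀ M N : Matrix σ σ R, M * N = 1 →
      Function.LeftInverse (subst (linearVec N)) (subst (linearVec M) : MvPowerSeries σ R → _) := by
    intro M N hMN f
    rw [subst_comp_subst_apply (hasSubst_of_one_le_order (one_le_order_linearVec M))
      (hasSubst_of_one_le_order (one_le_order_linearVec N))]
    simp only [subst_linearVec (hasSubst_of_one_le_order (one_le_order_linearVec N)),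
      sum_linearVec, hMN, linearVec_one]
    exact congrFun subst_self f
  exact ⟨(hcomp M M⁻¹ (Matrix.mul_nonsing_inv M hM)).injective,
    (hcomp M⁻¹ M (Matrix.nonsing_inv_mul M hM)).surjective⟩

/-- Formal inverse function theorem: a substitution with invertible linear part is bijective. -/
theorem bijective_subst [DecidableEq σ] {a : σ → MvPowerSeries σ R} {M : Matrix σ σ R}
    (hM : IsUnit M.det)
    (ha : ∀ i, 2 ≤ (a i - linearVec M i).order) :
    Function.Bijective (subst a : MvPowerSeries σ R → MvPowerSeries σ R) := by
  let a' : σ → MvPowerSeries σ R := fun i => ∑ j, C (M⁻¹ i j) * a j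
  have ha' : ∀ i, 2 ≤ (a' i - X i).order := by
    intro i
    have : a' i - X i = ∑ j, M⁻¹ i j • (a j - linearVec M j) := by
      rw [← linearVec_one, ← Matrix.nonsing_inv_mul M hM, ← sum_linearVec, ← Finset.sum_sub_distrib]
      exact Finset.sum_congr rfl fun j _ => by rw [smul_eq_C_mul, mul_sub]
    rw [this]
    exact le_order_sum _ _ fun j _ => (ha j).trans le_order_smul
  have hs' : HasSubst a' := hasSubst_of_one_le_order (one_le_order_of_sub_X ha')
  have haa' : a = fun i => subst a' (linearVec M i) := by
    funext i
    rw [subst_linearVec hs']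
    simp only [a', Finset.mul_sum, ← mul_assoc, ← map_mul]
    rw [Finset.sum_comm]
    simp only [← Finset.sum_mul, ← map_sum, ← Matrix.mul_apply, Matrix.mul_nonsing_inv M hM]
    rw [Finset.sum_eq_single i] <;> simp +contextual [eq_comm]
  have := (bijective_subst_of_le_order_sub ha').comp (bijective_subst_linearVec hM)
  rw [subst_comp_subst (hasSubst_of_one_le_order (one_le_order_linearVec M)) hs', ← haa'] at this
  exact this

end MvPowerSeries

/-! ### Recognition of `A₃`-singularities -/

namespace QuarticSurface

open MvPowerSeries

variable {K : Type*} [Field K]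

/-- The quadratic equation `S = 1 + r S²` is solved by the Catalan series. -/
lemma exists_eq_one_add_mul_sq {σ : Type*} (r : MvPowerSeries σ K) (hr : constantCoeff r = 0) :
    ∃ S : MvPowerSeries σ K, S = S ^ 2 * r + 1 := by
  have hs : PowerSeries.HasSubst r := PowerSeries.HasSubst.of_constantCoeff_zero hr
  let c : PowerSeries K := PowerSeries.catalanSeries.map (Nat.castRingHom K)
  have hc : c = c ^ 2 * PowerSeries.X + 1 := by
    have := congrArg (PowerSeries.map (Nat.castRingHom K))
      PowerSeries.catalanSeries_sq_mul_X_add_one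
    rw [map_add, map_mul, map_pow, PowerSeries.map_X, map_one] at this
    exact this.symm
  refine ⟨PowerSeries.substAlgHom hs c, ?_⟩
  conv_lhs => rw [hc]
  rw [map_add, map_mul, map_pow, PowerSeries.substAlgHom_X, map_one]

variable [IsAlgClosed K] [CharP K 2]

/-- In characteristic two a quadratic polynomial over a ring of formal power series has a root
once its middle coefficient is a unit. -/
lemma exists_quadratic_root {σ : Type*} (a b c : MvPowerSeries σ K) (hb : constantCoeff b ≠ 0) :
    ∃ t : MvPowerSeries σ K, a * t ^ 2 + b * t + c = 0 := by
  have h2 : (2 : MvPowerSeries σ K) = 0 := by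
    rw [← map_ofNat C 2, CharTwo.two_eq_zero, map_zero]
  obtain ⟨t₀, ht₀⟩ : ∃ t₀ : K,
      constantCoeff a * t₀ ^ 2 + constantCoeff b * t₀ + constantCoeff c = 0 := by
    rcases eq_or_ne (constantCoeff a) 0 with ha | ha
    · exact ⟨- constantCoeff c / constantCoeff b, by rw [ha]; field_simp; ring⟩
    · obtain ⟨t₀, h⟩ := IsAlgClosed.exists_root
        (Polynomial.C (constantCoeff a) * Polynomial.X ^ 2 +
          Polynomial.C (constantCoeff b) * Polynomial.X + Polynomial.C (constantCoeff c))
        (by rw [Polynomial.degree_quadratic ha]; decide)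
      exact ⟨t₀, by simpa [Polynomial.IsRoot] using h⟩
  set c' := a * C t₀ ^ 2 + b * C t₀ + c with hc'
  have hbb : b * b⁻¹ = 1 := MvPowerSeries.mul_inv_cancel b hb
  obtain ⟨S, hS⟩ := exists_eq_one_add_mul_sq (a * c' * b⁻¹ ^ 2) (by
    rw [map_mul, map_mul, hc']
    simp [ht₀])
  refine ⟨C t₀ - c' * b⁻¹ * S, ?_⟩
  have : a * (C t₀ - c' * b⁻¹ * S) ^ 2 + b * (C t₀ - c' * b⁻¹ * S) + c =
      c' * (S ^ 2 * (a * c' * b⁻¹ ^ 2) + 1 - S) - c' * (b * b⁻¹ - 1) * S -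
        2 * (a * C t₀ * c' * b⁻¹ * S) := by
    rw [hc']
    ring
  rw [this, ← hS, hbb, h2]
  ring

omit [IsAlgClosed K] [CharP K 2] in
lemma two_le_order_sub_mul_X (f : MvPowerSeries (Fin 3) K) (i : Fin 3) :
    2 ≤ (f * X i - C (constantCoeff f) * X i).order := by
  rw [← sub_mul]
  refine le_trans ?_ le_order_mul
  rw [show (2 : ℕ∞) = 1 + 1 by norm_num]
  refine add_le_add ?_ (one_le_order_X i)
  rw [one_le_order_iff_constCoeff_eq_zero]
  simp

/-- `z⁴ + a x² + b xy + c y²` with `b(0) ≠ 0` is formally equivalent to `xy - z⁴`: the quadratic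
form in `x` and `y` splits into two factors with independent linear parts. -/
theorem exists_algEquiv_of_eq {F a b c : MvPowerSeries (Fin 3) K} (hb : constantCoeff b ≠ 0)
    (hF : F = X 2 ^ 4 + a * X 0 ^ 2 + b * (X 0 * X 1) + c * X 1 ^ 2) :
    ∃ φ : MvPowerSeries (Fin 3) K ≃ₐ[K] MvPowerSeries (Fin 3) K,
      Ideal.map φ (Ideal.span {F}) = Ideal.span {X 0 * X 1 - X 2 ^ 4} := by
  have h2 : (2 : MvPowerSeries (Fin 3) K) = 0 := by
    rw [← map_ofNat C 2, CharTwo.two_eq_zero, map_zero]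
  have h2K : (2 : K) = 0 := CharTwo.two_eq_zero
  obtain ⟨t, ht⟩ := exists_quadratic_root a b c hb
  set w : Fin 3 → MvPowerSeries (Fin 3) K :=
    ![X 0 - t * X 1, a * X 0 + (b + a * t) * X 1, X 2] with hw
  set M : Matrix (Fin 3) (Fin 3) K := !![1, - constantCoeff t, 0;
    constantCoeff a, constantCoeff (b + a * t), 0; 0, 0, 1] with hM
  have hdet : M.det = constantCoeff b := by
    rw [Matrix.det_fin_three]
    simp [hM]
    linear_combination (constantCoeff a * constantCoeff t) * h2K
  have hord : ∀ i, 2 ≤ (w i - linearVec M i).order := by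
    have h0 : w 0 - linearVec M 0 = -(t * X 1 - C (constantCoeff t) * X 1) := by
      simp [hw, hM, linearVec, Fin.sum_univ_three]
      ring
    have h1 : w 1 - linearVec M 1 = (a * X 0 - C (constantCoeff a) * X 0) +
        ((b + a * t) * X 1 - C (constantCoeff (b + a * t)) * X 1) := by
      simp [hw, hM, linearVec, Fin.sum_univ_three]
      ring
    have h2 : w 2 - linearVec M 2 = 0 := by
      simp [hw, hM, linearVec, Fin.sum_univ_three]
    rw [Fin.forall_fin_succ, Fin.forall_fin_succ, Fin.forall_fin_one]
    refine ⟨?_, ?_, ?_⟩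
    · rw [h0, order_neg]
      exact two_le_order_sub_mul_X t 1
    · change 2 ≤ (w 1 - linearVec M 1).order
      rw [h1]
      exact le_order_add (two_le_order_sub_mul_X a 0) (two_le_order_sub_mul_X _ 1)
    · change 2 ≤ (w 2 - linearVec M 2).order
      rw [h2, order_zero]
      exact le_top
  have hsub : HasSubst w := hasSubst_of_constantCoeff_zero (by
    rw [Fin.forall_fin_succ, Fin.forall_fin_succ, Fin.forall_fin_one]
    refine ⟨?_, ?_, ?_⟩ <;> simp [hw])
  have hbij := bijective_subst (by rw [hdet]; exact isUnit_iff_ne_zero.mpr hb) hord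
  rw [← coe_substAlgHom hsub] at hbij
  let ψ := AlgEquiv.ofBijective (substAlgHom hsub) hbij
  have hψ : ψ (X 0 * X 1 - X 2 ^ 4) = F := by
    change substAlgHom hsub _ = F
    rw [map_sub, map_mul, map_pow, substAlgHom_X, substAlgHom_X, substAlgHom_X, hF]
    simp only [hw, Matrix.cons_val]
    linear_combination (- X 1 ^ 2) * ht - X 2 ^ 4 * h2
  refine ⟨ψ.symm, ?_⟩
  rw [Ideal.map_span, Set.image_singleton, ← hψ, AlgEquiv.symm_apply_apply]

end QuarticSurface

/-! ### The local equations at the singular points -/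

namespace QuarticSurface

open MvPolynomial
open scoped LinearAlgebra.Projectivization

variable {K : Type*} [Field K]

lemma sq_aeval_congr {σ Q : Type*} [CommRing Q] [Algebra K Q] (h2 : (2 : Q) = 0) {x y : σ → Q}
    (h : ∀ j, x j ^ 2 = y j ^ 2) (q : MvPolynomial σ K) : aeval x q ^ 2 = aeval y q ^ 2 := by
  induction q using MvPolynomial.induction_on with
  | C a => simp
  | add p q hp hq =>
    rw [map_add, map_add]
    linear_combination hp + hq + (aeval x p * aeval x q - aeval y p * aeval y q) * h2
  | mul_X p j hp => rw [map_mul, map_mul, aeval_X, aeval_X, mul_pow, mul_pow, hp, h]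

variable [CharP K 2]

/-- The Taylor expansion of the quartic at a singular point, modulo the squares of the
infinitesimals `ηⱼ`. -/
lemma aeval_quartic_add {Q : Type*} [CommRing Q] [Algebra K Q] (h2 : (2 : Q) = 0)
    {q : MvPolynomial (Fin 3) K} {L : Matrix (Fin 3) (Fin 3) K} {w : Fin 3 → K} {z c : K}
    (hz : z ^ 4 = eval w (formOf q L)) (hw : sqMap L w = c • w) {x η : Fin 4 → Q}
    (hη : ∀ j : Fin 3, η j.castSucc ^ 2 = 0)
    (hx : ∀ j : Fin 3, x j.castSucc = algebraMap K Q (w j) + η j.castSucc)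
    (hx3 : x 3 = algebraMap K Q z + η 3) :
    aeval x (quartic (formOf q L)) = η 3 ^ 4 +
      ∑ k : Fin 3, algebraMap K Q (c * w k) * (η (k + 1).castSucc * η (k + 2).castSucc) := by
  have hsq : ∀ p : MvPolynomial (Fin 3) K,
      aeval (fun j : Fin 3 => x j.castSucc) p ^ 2 = algebraMap K Q (eval w p) ^ 2 := by
    intro p
    rw [sq_aeval_congr h2 (y := fun j => algebraMap K Q (w j)) (fun j => ?_)]
    · exact congrArg (· ^ 2) (aeval_algebraMap_apply Q w p)
    · rw [hx]
      linear_combination hη j + algebraMap K Q (w j) * η j.castSucc * h2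
  have hl : ∀ k, algebraMap K Q (eval w (linForm (L k))) ^ 2 = algebraMap K Q (c * w k) := by
    intro k
    rw [← map_pow, ← sqMap_apply, hw]
    rfl
  have hz' : algebraMap K Q z ^ 4 = algebraMap K Q (eval w q) ^ 2 +
      3 * algebraMap K Q c * algebraMap K Q (w 0) * algebraMap K Q (w 1) * algebraMap K Q (w 2) := by
    have : eval w (formOf q L) = eval w q ^ 2 + 3 * c * w 0 * w 1 * w 2 := by
      simp only [formOf, map_add, map_mul, map_pow, eval_X, ← sqMap_apply, hw,
        Fin.sum_univ_three, Pi.smul_apply, smul_eq_mul]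
      simp only [show (1 : Fin 3) + 1 = 2 from rfl, show (1 : Fin 3) + 2 = 0 from rfl,
        show (2 : Fin 3) + 1 = 0 from rfl, show (2 : Fin 3) + 2 = 1 from rfl, zero_add]
      ring
    rw [← map_pow, hz, this]
    simp only [map_add, map_mul, map_pow, map_ofNat]
  rw [aeval_quartic, hx3]
  simp only [formOf, map_add, map_sum, map_mul, map_pow, aeval_X, hsq, hl]
  simp only [hx, Fin.sum_univ_three, show (1 : Fin 3) + 1 = 2 from rfl,
    show (1 : Fin 3) + 2 = 0 from rfl, show (2 : Fin 3) + 1 = 0 from rfl,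
    show (2 : Fin 3) + 2 = 1 from rfl, zero_add]
  generalize algebraMap K Q (w 0) = w₀ at *
  generalize algebraMap K Q (w 1) = w₁ at *
  generalize algebraMap K Q (w 2) = w₂ at *
  generalize algebraMap K Q c = c' at *
  generalize algebraMap K Q z = z' at *
  generalize algebraMap K Q (eval w q) = q' at *
  generalize η (Fin.castSucc 0) = η₀
  generalize η (Fin.castSucc 1) = η₁
  generalize η (Fin.castSucc 2) = η₂
  linear_combination hz' + (q' ^ 2 + 3 * c' * w₀ * w₁ * w₂ + 2 * z' ^ 3 * η 3 +
    3 * z' ^ 2 * η 3 ^ 2 + 2 * z' * η 3 ^ 3 +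
    c' * (w₀ * w₁ * η₂ + w₀ * w₂ * η₁ + w₁ * w₂ * η₀)) * h2

/-- At a singular point that is a nondegenerate eigenline of the semilinear map, the quartic has
an `A₃`-singularity. -/
theorem hasTypeA_three [IsAlgClosed K] {q : MvPolynomial (Fin 3) K}
    {L : Matrix (Fin 3) (Fin 3) K} (hB : (formOf q L).IsHomogeneous 4)
    (hL : Function.Injective (sqMap L)) {P : ℙ K (Fin 4 → K)}
    (hP : P ∈ singularPoints (quartic (formOf q L))) : HasTypeA 3 (quartic (formOf q L)) P := by
  obtain ⟨hx, c, hc⟩ := exists_eigenvalue hB rfl hP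
  have h4 := ((mem_singularPoints_iff rfl P).mp hP).1
  set x : Fin 3 → K := fun j => P.rep j.castSucc with hxdef
  have hc0 : c ≠ 0 := by
    rintro rfl
    rw [zero_smul] at hc
    exact hx (hL (hc.trans (map_zero _).symm))
  obtain ⟨i, hi⟩ := Function.ne_iff.mp hx
  have hi : x i ≠ 0 := hi
  refine ⟨i.castSucc, hi, ?_⟩
  -- coordinates normalized as in the `i`-th chart
  let w : Fin 3 → K := (x i)⁻¹ • x
  have hwi : w i = 1 := inv_mul_cancel₀ hi
  have hw : sqMap L w = (c * (x i)⁻¹) • w := by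
    rw [map_smulₛₗ, hc, smul_smul, smul_smul, frobenius_def]
    congr 1
    ring
  have hz : (P.rep 3 / x i) ^ 4 = eval w (formOf q L) := by
    rw [IsHomogeneous.eval_smul hB, div_pow, h4, inv_pow]
    ring
  -- modulo `I = (X₀², X₁²)` the Taylor expansion is `X₂⁴ + c xᵢ⁻¹ X₀ X₁`
  let I : Ideal (MvPolynomial (Fin 3) K) := Ideal.span {X 0 ^ 2, X 1 ^ 2}
  let η : Fin 4 → MvPolynomial (Fin 3) K := i.castSucc.insertNth (0 : MvPolynomial (Fin 3) K) X
  have hη3 : η 3 = X 2 := by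
    fin_cases i <;> rfl
  have hηI : ∀ j : Fin 3, Ideal.Quotient.mk I (η j.castSucc) ^ 2 = 0 := by
    have h0 : Ideal.Quotient.mk I (X 0) ^ 2 = 0 := by
      rw [← map_pow, Ideal.Quotient.eq_zero_iff_mem]
      exact Ideal.subset_span (by simp)
    have h1 : Ideal.Quotient.mk I (X 1) ^ 2 = 0 := by
      rw [← map_pow, Ideal.Quotient.eq_zero_iff_mem]
      exact Ideal.subset_span (by simp)
    have h00 : Ideal.Quotient.mk I 0 ^ 2 = 0 := by simp
    intro j
    fin_cases i <;> fin_cases j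
    exacts [h00, h0, h1, h0, h00, h1, h0, h1, h00]
  have hsum : ∑ k : Fin 3, algebraMap K (MvPolynomial (Fin 3) K) (c * (x i)⁻¹ * w k) *
      (η (k + 1).castSucc * η (k + 2).castSucc) = C (c * (x i)⁻¹) * (X 0 * X 1) := by
    rw [Finset.sum_eq_single i]
    · rw [hwi, mul_one]
      refine congrArg (C (c * (x i)⁻¹) * ·) ?_
      fin_cases i
      exacts [rfl, mul_comm _ _, rfl]
    · intro k _ hk
      have : η (k + 1).castSucc * η (k + 2).castSucc = 0 := by
        have hi0 : η i.castSucc = 0 := Fin.insertNth_apply_same _ _ _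
        have : k + 1 = i ∨ k + 2 = i := by revert hk; clear * -; revert i k; decide
        rcases this with h | h <;> rw [h, hi0] <;> simp
      rw [this, mul_zero]
    · simp
  let T : MvPolynomial (Fin 3) K := aeval (fun j : Fin 3 =>
    X j + C (P.rep (i.castSucc.succAbove j) / P.rep i.castSucc))
    (dehomogenize i.castSucc (quartic (formOf q L)))
  have hmem : T - (X 2 ^ 4 + C (c * (x i)⁻¹) * (X 0 * X 1)) ∈ I := by
    rw [← Ideal.Quotient.eq, ← hsum, ← hη3]
    let y : Fin 4 → MvPolynomial (Fin 3) K := fun k => C (P.rep k / P.rep i.castSucc) + η k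
    have hT : T = aeval y (quartic (formOf q L)) := by
      change aeval _ _ = _
      rw [aeval_dehomogenize]
      congr 2
      ext1 k
      refine Fin.succAboveCases i.castSucc ?_ (fun j => ?_) k
      · rw [Fin.insertNth_apply_same]
        change 1 = C (x i / x i) + η i.castSucc
        rw [div_self hi, C_1, show η i.castSucc = 0 from Fin.insertNth_apply_same _ _ _, add_zero]
      · rw [Fin.insertNth_apply_succAbove]
        change _ = C _ + η (i.castSucc.succAbove j)
        rw [show η (i.castSucc.succAbove j) = X j from Fin.insertNth_apply_succAbove _ _ _ _, add_comm]
    have h2 : (2 : MvPolynomial (Fin 3) K ⧸ I) = 0 := by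
      rw [← map_ofNat (algebraMap K (MvPolynomial (Fin 3) K ⧸ I)) 2, CharTwo.two_eq_zero, map_zero]
    have key := aeval_quartic_add (Q := MvPolynomial (Fin 3) K ⧸ I) h2 hz hw
      (x := fun k => Ideal.Quotient.mk I (y k))
      (η := fun k => Ideal.Quotient.mk I (η k)) hηI (fun j => by
        change Ideal.Quotient.mk I (C (x j / x i) + η j.castSucc) = _
        rw [map_add, div_eq_inv_mul]
        rfl) (map_add _ _ _)
    have hmk : Ideal.Quotient.mk I T = aeval (fun k => Ideal.Quotient.mk I (y k))
        (quartic (formOf q L)) := by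
      rw [hT]
      exact comp_aeval_apply y (Ideal.Quotient.mkₐ K I) _
    rw [hmk, key]
    simp only [map_add, map_sum, map_mul, map_pow]
    rfl
  obtain ⟨a, b, hab⟩ := Ideal.mem_span_pair.mp hmem
  have hTeq : T = X 2 ^ 4 + a * X 0 ^ 2 + C (c * (x i)⁻¹) * (X 0 * X 1) + b * X 1 ^ 2 := by
    linear_combination -hab
  refine exists_algEquiv_of_eq (F := (T : MvPowerSeries (Fin 3) K)) (a := a)
    (b := MvPowerSeries.C (c * (x i)⁻¹)) (c := b) ?_ ?_
  · simpa using ⟨hc0, hi⟩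
  · rw [hTeq]
    simp only [MvPolynomial.coe_add, MvPolynomial.coe_mul, MvPolynomial.coe_pow,
      MvPolynomial.coe_X, MvPolynomial.coe_C]

/-! ### General quartic forms -/

/-- The determinant of the coefficients of the monomials `x_{i+1} x_{i+2} x_j²`. It is the square
of `det L` for the form `formOf q L`. -/
noncomputable def oddDet (K : Type*) [Field K] :
    MvPolynomial {m : Fin 3 →₀ ℕ // m.degree = 4} K :=
  (Matrix.of fun i j => X ⟨oddExp i j, degree_oddExp i j⟩ : Matrix (Fin 3) (Fin 3) _).det

omit [CharP K 2] in
lemma eval_oddDet (p : {m : Fin 3 →₀ ℕ // m.degree = 4} → K) :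
    eval p (oddDet K) = (Matrix.of fun i j => p ⟨oddExp i j, degree_oddExp i j⟩ :
      Matrix (Fin 3) (Fin 3) K).det := by
  rw [oddDet, RingHom.map_det]
  congr 1
  ext i j
  simp

omit [CharP K 2] in
/-- The form `x₀x₁x₂(x₀ + x₁ + x₂)` has determinant one. -/
lemma oddDet_ne_zero : oddDet K ≠ 0 := by
  classical
  intro h
  have := congrArg (eval fun m => if ∀ k, 1 ≤ m.1 k then (1 : K) else 0) h
  rw [eval_oddDet, map_zero] at this
  have hone : (Matrix.of fun i j => if ∀ k, 1 ≤ oddExp i j k then (1 : K) else 0) =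
      (1 : Matrix (Fin 3) (Fin 3) K) := by
    ext i j
    have hiff : (∀ k, 1 ≤ oddExp i j k) ↔ i = j := by
      simp only [oddExp_apply]
      revert i j
      decide
    rw [Matrix.of_apply, Matrix.one_apply]
    exact if_congr hiff rfl rfl
  rw [hone, Matrix.det_one] at this
  exact one_ne_zero this

lemma det_ne_zero_of_eval_oddDet_ne_zero {B : MvPolynomial (Fin 3) K}
    {L : Matrix (Fin 3) (Fin 3) K} (hL : ∀ i j, coeff (oddExp i j) B = L i j ^ 2)
    (h : eval (fun m => coeff m.1 B) (oddDet K) ≠ 0) : L.det ≠ 0 := by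
  intro h0
  refine h ?_
  rw [eval_oddDet]
  have : (Matrix.of fun i j => coeff (oddExp i j) B) = (frobenius K 2).mapMatrix L := by
    ext i j
    simp [hL, frobenius_def]
  rw [this, ← RingHom.map_det, h0, map_zero]

end QuarticSurface

theorem mainTheorem11 (K : Type*) [Field K] [IsAlgClosed K] [CharP K 2] :
    (∀ B : MvPolynomial (Fin 3) K, B.IsHomogeneous 4 →
      QuarticSurface.IsNormalSurface (QuarticSurface.quartic B) →
        (QuarticSurface.singularPoints (QuarticSurface.quartic B)).encard ≤ 7) ∧
    QuarticSurface.ForGeneralForm 4 (fun B : MvPolynomial (Fin 3) K =>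
      QuarticSurface.IsNormalSurface (QuarticSurface.quartic B) ∧
      (QuarticSurface.singularPoints (QuarticSurface.quartic B)).encard = 7 ∧
      ∀ P ∈ QuarticSurface.singularPoints (QuarticSurface.quartic B),
        QuarticSurface.HasTypeA 3 (QuarticSurface.quartic B) P) := by
  constructor
  · intro B hB hnorm
    obtain ⟨q, L, rfl, -⟩ := QuarticSurface.exists_eq_formOf hB
    have hker := QuarticSurface.ker_sqMap L
    obtain h | h | h : Module.finrank K (LinearMap.ker (QuarticSurface.sqMap L)) = 0 ∨
        Module.finrank K (LinearMap.ker (QuarticSurface.sqMap L)) = 1 ∨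
        2 ≤ Module.finrank K (LinearMap.ker (QuarticSurface.sqMap L)) := by omega
    · exact (QuarticSurface.encard_singularPoints_of_injective hB rfl
        (LinearMap.ker_eq_bot.mp (Submodule.finrank_eq_zero.mp h))).le
    · exact QuarticSurface.encard_singularPoints_le_of_finrank_ker_eq_one hB rfl h
    · exact absurd hnorm (QuarticSurface.not_isNormalSurface q (hker ▸ h))
  · refine ⟨QuarticSurface.oddDet K, QuarticSurface.oddDet_ne_zero, fun B hB hG => ?_⟩
    obtain ⟨q, L, rfl, hcoeff⟩ := QuarticSurface.exists_eq_formOf hB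
    have hdet := QuarticSurface.det_ne_zero_of_eval_oddDet_ne_zero hcoeff hG
    have hL : Function.Injective (QuarticSurface.sqMap L) := by
      rw [← LinearMap.ker_eq_bot, QuarticSurface.ker_sqMap, LinearMap.ker_eq_bot]
      exact Matrix.mulVec_injective_of_isUnit
        ((Matrix.isUnit_iff_isUnit_det L).mpr (isUnit_iff_ne_zero.mpr hdet))
    exact ⟨QuarticSurface.isNormalSurface_quartic hB (QuarticSurface.isUnit_of_dvd_pderiv q hL),
      QuarticSurface.encard_singularPoints_of_injective hB rfl hL,
      fun P hP => QuarticSurface.hasTypeA_three hB hL hP⟩
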